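/- **Setting.** An instance consists of a finite set $\mathcal C$ of customers, a finite set $\mathcal S$ of suppliers, and for each agent $a$ a choice model over the agents of the opposite side: for every assortment (set) $T$ of agents of the opposite side, numbers $\phi_a(b,T)\ge 0$ with $\phi_a(b,T)=0$ for $b\notin T\cup\{0\}$ and $\sum_{b\in T\cup\{0\}}\phi_a(b,T)=1$, where $0$ is the outside option; $\phi_a(b,T)$ is the probability that $a$ chooses $b$ when offered $T$. The demand function of $a$ is $f_a(T)=\sum_{b\in T}\phi_a(b,T)$. It is assumed throughout that every $f_a$ is monotone and submodular. A (possibly randomized) policy repeatedly selects a set of agents not yet processed, offers each of them an assortment, and observes their choices, which are made independently and irrevocably; each agent is processed exactly once, and later decisions may depend on the observed choices. A match is a customer and a supplier who have chosen each other, and the value of a policy is its expected number of matches. A *one-sided static* policy commits to one side (customers or suppliers), processes all agents of that side simultaneously, and then processes the other side. A *one-sided adaptive* policy commits to one side, processes the agents of that side one by one, and then processes the other side. The agents processed in the second phase are called responding agents. Let $\mathrm{OPT}_{\sf OS}(I)$ and $\mathrm{OPT}_{\sf OA}(I)$ be the suprema of the values of one-sided static and of one-sided adaptive policies on the instance $I$.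 Let $\mathrm{OPT}^{\sf b}_{\sf OS}(I)$ and $\mathrm{OPT}^{\sf b}_{\sf OA}(I)$ be the same suprema over those policies that offer to each responding agent only agents who have chosen it. Call a choice model *substitutable* if enlarging an assortment does not increase the probability that a member of the original assortment is chosen: $\sum_{b\in T}\phi_a(b,T')\le f_a(T)$ whenever $T\subseteq T'$. **Theorem.** The adaptivity gap between one-sided static and one-sided adaptive policies is exactly $e/(e-1)$. Precisely: (A) For every instance $I$ (with monotone submodular demand functions), $\mathrm{OPT}^{\sf b}_{\sf OA}(I)\le\frac{e}{e-1}\,\mathrm{OPT}^{\sf b}_{\sf OS}(I)$, and $$\sup_I \frac{\mathrm{OPT}^{\sf b}_{\sf OA}(I)}{\mathrm{OPT}^{\sf b}_{\sf OS}(I)}=\frac{e}{e-1},$$ the supremum being over all instances with $\mathrm{OPT}^{\sf b}_{\sf OS}(I)>0$. (B) For every instance $I$ (with monotone submodular demand functions) in which all choice models are substitutable, $\mathrm{OPT}_{\sf OA}(I)\le\frac{e}{e-1}\,\mathrm{OPT}_{\sf OS}(I)$, and $$\sup_I \frac{\mathrm{OPT}_{\sf OA}(I)}{\mathrm{OPT}_{\sf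 OS}(I)}=\frac{e}{e-1},$$ the supremum being over all such instances with $\mathrm{OPT}_{\sf OS}(I)>0$. (C) There are instances $I_n$ with $n$ customers and $n$ suppliers, with monotone submodular demand functions and substitutable choice models, such that $$\lim_{n\to\infty}\frac{\mathrm{OPT}^{\sf b}_{\sf OA}(I_n)}{\mathrm{OPT}^{\sf b}_{\sf OS}(I_n)}=\lim_{n\to\infty}\frac{\mathrm{OPT}_{\sf OA}(I_n)}{\mathrm{OPT}_{\sf OS}(I_n)}=\frac{e}{e-1}.$$ -/

import Mathlib

open Finset

noncomputable section

/-- A discrete choice model over a finite set `α` of alternatives: `prob (some j) S` is the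
probability of choosing the alternative `j` when the assortment `S` is offered, and `prob none S`
is the probability of choosing the outside option. -/
structure ChoiceModel (α : Type*) where
  prob : Option α → Finset α → ℝ
  prob_nonneg : ∀ o S, 0 ≤ prob o S
  prob_eq_zero : ∀ j S, j ∉ S → prob (some j) S = 0
  sum_eq_one : ∀ S, prob none S + ∑ j ∈ S, prob (some j) S = 1

namespace ChoiceModel

/-- The demand function: the probability that some member of the assortment is chosen. -/
def demand {α : Type*} (φ : ChoiceModel α) (S : Finset α) : ℝ :=
  ∑ j ∈ S, φ.prob (some j) S

/-- The demand function is monotone and submodular (diminishing marginal returns). -/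
def MonotoneSubmodular {α : Type*} [DecidableEq α] (φ : ChoiceModel α) : Prop :=
  Monotone φ.demand ∧
    ∀ (E E' : Finset α) (e : α), E ⊆ E' → e ∉ E' →
      φ.demand (insert e E') - φ.demand E' ≤ φ.demand (insert e E) - φ.demand E

/-- Enlarging the assortment from `S` to `T` does not increase the probability that a
member of `S` is chosen. -/
def Substitutable {α : Type*} (φ : ChoiceModel α) : Prop :=
  ∀ S T : Finset α, S ⊆ T → ∑ j ∈ S, φ.prob (some j) T ≤ φ.demand S

end ChoiceModel

/-- An instance: a choice model over suppliers for every customer in `C`, and a choice model over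
customers for every supplier in `S`. -/
structure Market (C S : Type*) where
  customer : C → ChoiceModel S
  supplier : S → ChoiceModel C

/-- Adaptive randomized policies, as decision trees, for the situation in which the customers in
`RC` and the suppliers in `RS` remain to be processed.

* `done`: nobody remains, the policy stops.
* `random p next`: the policy draws `k` with probability `p k` and continues with `next k`.
* `process AC AS σ τ next`: the policy processes the customers in `AC` and the suppliers in `AS`
  simultaneously, offering `σ i` to the customer `i` and `τ j` to the supplier `j`; it observes their
  choices `u` and `v` and continues with `next u v` on the remaining agents. -/
inductive Policy (C S : Type*) [DecidableEq C] [DecidableEq S] :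
    Finset C → Finset S → Type _
  | done : Policy C S ∅ ∅
  | random {RC : Finset C} {RS : Finset S} (p : PMF ℕ) (next : ℕ → Policy C S RC RS) :
      Policy C S RC RS
  | process {RC : Finset C} {RS : Finset S} (AC : Finset C) (AS : Finset S)
      (hAC : AC ⊆ RC) (hAS : AS ⊆ RS) (σ : AC → Finset S) (τ : AS → Finset C)
      (next : (AC → Option S) → (AS → Option C) → Policy C S (RC \ AC) (RS \ AS)) :
      Policy C S RC RS

/-- Records the choices `u` of the agents in `A` in the history `x`. -/
def record {α β : Type*} [DecidableEq α] (x : α → Option β) {A : Finset α} (u : A → Option β) :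
    α → Option β :=
  fun a => if h : a ∈ A then u ⟨a, h⟩ else x a

section

variable {C S : Type*} [Fintype C] [Fintype S] [DecidableEq C] [DecidableEq S]

/-- The number of matches: pairs of a customer and a supplier who have chosen each other. -/
def matchCount (x : C → Option S) (y : S → Option C) : ℕ :=
  #{q : C × S | x q.1 = some q.2 ∧ y q.2 = some q.1}

namespace Policy

/-- The expected total number of matches under a policy, given the choices `x`, `y` observed so
far (`none` for the agents who chose the outside option or have not been processed). Agents who are
processed choose independently of each other and of the past, according to their choice models. -/
def value (M : Market C S) {RC : Finset C} {RS : Finset S} :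
    Policy C S RC RS → (C → Option S) → (S → Option C) → ℝ
  | done, x, y => matchCount x y
  | random p next, x, y => ∑' k, (p k).toReal * (next k).value M x y
  | process AC AS _ _ σ τ next, x, y =>
      ∑ u : AC → Option S, ∑ v : AS → Option C,
        (∏ i : AC, (M.customer i).prob (u i) (σ i)) * (∏ j : AS, (M.supplier j).prob (v j) (τ j)) *
          (next u v).value M (record x u) (record y v)

/-- All the customers are processed in one step, and then the suppliers (in any manner). -/
def CustomersFirstStatic {RC : Finset C} {RS : Finset S} : Policy C S RC RS → Prop
  | done => True
  | random _ next => ∀ k, (next k).CustomersFirstStatic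
  | process AC AS _ _ _ _ next =>
      (RC ≠ ∅ → AC = RC ∧ AS = ∅) ∧ ∀ u v, (next u v).CustomersFirstStatic

/-- All the suppliers are processed in one step, and then the customers (in any manner). -/
def SuppliersFirstStatic {RC : Finset C} {RS : Finset S} : Policy C S RC RS → Prop
  | done => True
  | random _ next => ∀ k, (next k).SuppliersFirstStatic
  | process AC AS _ _ _ _ next =>
      (RS ≠ ∅ → AS = RS ∧ AC = ∅) ∧ ∀ u v, (next u v).SuppliersFirstStatic

/-- The customers are processed one by one, and then the suppliers (in any manner). -/
def CustomersFirstAdaptive {RC : Finset C} {RS : Finset S} : Policy C S RC RS → Prop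
  | done => True
  | random _ next => ∀ k, (next k).CustomersFirstAdaptive
  | process AC AS _ _ _ _ next =>
      (RC ≠ ∅ → #AC = 1 ∧ AS = ∅) ∧ ∀ u v, (next u v).CustomersFirstAdaptive

/-- The suppliers are processed one by one, and then the customers (in any manner). -/
def SuppliersFirstAdaptive {RC : Finset C} {RS : Finset S} : Policy C S RC RS → Prop
  | done => True
  | random _ next => ∀ k, (next k).SuppliersFirstAdaptive
  | process AC AS _ _ _ _ next =>
      (RS ≠ ∅ → #AS = 1 ∧ AC = ∅) ∧ ∀ u v, (next u v).SuppliersFirstAdaptive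

/-- Once one side has been completely processed, every agent of the other side is offered only
agents who have chosen them. (`x` and `y` are the choices observed so far.) -/
def OffersBacklog {RC : Finset C} {RS : Finset S} :
    Policy C S RC RS → (C → Option S) → (S → Option C) → Prop
  | done, _, _ => True
  | random _ next, x, y => ∀ k, (next k).OffersBacklog x y
  | process _ _ _ _ σ τ next, x, y =>
      (RC = ∅ → ∀ j, ∀ i ∈ τ j, x i = some j.1) ∧
      (RS = ∅ → ∀ i, ∀ j ∈ σ i, y j = some i.1) ∧
      ∀ u v, (next u v).OffersBacklog (record x u) (record y v)

end Policy

variable (C S) in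
/-- All policies, from the start, when nobody has been processed. -/
abbrev FullPolicy := Policy C S (univ : Finset C) (univ : Finset S)

variable (C S) in
/-- One-sided static policies: each is committed to the side that is processed first. -/
def oneSidedStatic : Set (FullPolicy C S) :=
  {π | π.CustomersFirstStatic ∨ π.SuppliersFirstStatic}

variable (C S) in
/-- One-sided adaptive policies: each is committed to the side that is processed first. -/
def oneSidedAdaptive : Set (FullPolicy C S) :=
  {π | π.CustomersFirstAdaptive ∨ π.SuppliersFirstAdaptive}

variable (C S) in
/-- Policies that offer to the responding side only agents of the initiating side who have
chosen them. -/
def backlogOnly : Set (FullPolicy C S) :=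
  {π | π.OffersBacklog (fun _ => none) (fun _ => none)}

namespace Market

/-- The expected number of matches of a policy. -/
def expectedMatches (M : Market C S) (π : FullPolicy C S) : ℝ :=
  π.value M (fun _ => none) (fun _ => none)

/-- The optimal value over a class `Q` of policies. -/
def opt (M : Market C S) (Q : Set (FullPolicy C S)) : ℝ :=
  sSup (M.expectedMatches '' Q)

/-- The optimal value over one-sided static policies. -/
def optOS (M : Market C S) : ℝ := M.opt (oneSidedStatic C S)

/-- The optimal value over one-sided adaptive policies. -/
def optOA (M : Market C S) : ℝ := M.opt (oneSidedAdaptive C S)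

/-- The optimal value over one-sided static policies that offer to the responding side only
agents who have chosen them. -/
def optOSBacklog (M : Market C S) : ℝ := M.opt (oneSidedStatic C S ∩ backlogOnly C S)

/-- The optimal value over one-sided adaptive policies that offer to the responding side only
agents who have chosen them. -/
def optOABacklog (M : Market C S) : ℝ := M.opt (oneSidedAdaptive C S ∩ backlogOnly C S)

/-- The demand function of every agent is monotone and submodular. -/
def MonotoneSubmodular (M : Market C S) : Prop :=
  (∀ i, (M.customer i).MonotoneSubmodular) ∧ ∀ j, (M.supplier j).MonotoneSubmodular

/-- The choice model of every agent is substitutable. -/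
def Substitutable (M : Market C S) : Prop :=
  (∀ i, (M.customer i).Substitutable) ∧ ∀ j, (M.supplier j).Substitutable

end Market

end

/-! The suprema that define optimal values are over non-empty bounded sets. -/

section Sanity

variable {C S : Type*} [Fintype C] [Fintype S] [DecidableEq C] [DecidableEq S]

theorem ChoiceModel.sum_prob {α : Type*} [Fintype α] (φ : ChoiceModel α) (T : Finset α) :
    ∑ o, φ.prob o T = 1 := by
  rw [Fintype.sum_option, ← φ.sum_eq_one T]
  congr 1
  exact (Finset.sum_subset (subset_univ T) fun j _ hj => φ.prob_eq_zero j T hj).symm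

theorem matchCount_le (x : C → Option S) (y : S → Option C) :
    matchCount x y ≤ Fintype.card C := by
  unfold matchCount
  rw [← Finset.card_univ]
  refine Finset.card_le_card_of_injOn Prod.fst (fun _ _ => mem_univ _) ?_
  rintro ⟨i, j⟩ h ⟨i', j'⟩ h' (rfl : i = i')
  simp only [coe_filter, mem_univ, true_and, Set.mem_ofPred_eq] at h h'
  have := h.1.symm.trans h'.1
  simp_all

theorem Policy.value_mem_Icc (M : Market C S) {RC : Finset C} {RS : Finset S}
    (π : Policy C S RC RS) (x : C → Option S) (y : S → Option C) :
    π.value M x y ∈ Set.Icc (0 : ℝ) (Fintype.card C) := by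
  induction π generalizing x y with
  | done =>
    rw [value]
    exact ⟨Nat.cast_nonneg _, Nat.cast_le.2 (matchCount_le x y)⟩
  | random p next ih =>
    rw [value]
    have hp : HasSum (fun k => (p k).toReal) 1 := by
      have h := ENNReal.hasSum_toReal (f := fun k => p k) (by rw [p.tsum_coe]; simp)
      rwa [← ENNReal.tsum_toReal_eq fun k => p.apply_ne_top k, p.tsum_coe,
        ENNReal.toReal_one] at h
    have h0 : ∀ k, 0 ≤ (p k).toReal * (next k).value M x y := fun k =>
      mul_nonneg ENNReal.toReal_nonneg (ih k x y).1
    have h1 : ∀ k, (p k).toReal * (next k).value M x y ≤ (p k).toReal * Fintype.card C := fun k =>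
      mul_le_mul_of_nonneg_left (ih k x y).2 ENNReal.toReal_nonneg
    have hs := hp.mul_right (Fintype.card C : ℝ)
    refine ⟨tsum_nonneg h0, ?_⟩
    have h2 := (Summable.of_nonneg_of_le h0 h1 hs.summable).tsum_le_tsum h1 hs.summable
    rwa [hs.tsum_eq, one_mul] at h2
  | process AC AS hAC hAS σ τ next ih =>
    rw [value]
    have hu : ∀ u : AC → Option S, 0 ≤ ∏ i : AC, (M.customer i).prob (u i) (σ i) := fun u =>
      prod_nonneg fun i _ => (M.customer i).prob_nonneg _ _
    have hv : ∀ v : AS → Option C, 0 ≤ ∏ j : AS, (M.supplier j).prob (v j) (τ j) := fun v =>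
      prod_nonneg fun j _ => (M.supplier j).prob_nonneg _ _
    refine ⟨sum_nonneg fun u _ => sum_nonneg fun v _ =>
      mul_nonneg (mul_nonneg (hu u) (hv v)) (ih u v _ _).1, ?_⟩
    have hsu : ∑ u : AC → Option S, ∏ i : AC, (M.customer i).prob (u i) (σ i) = 1 := by
      rw [← Fintype.prod_sum fun (i : AC) o => (M.customer i).prob o (σ i)]
      exact prod_eq_one fun i _ => (M.customer i).sum_prob _
    have hsv : ∑ v : AS → Option C, ∏ j : AS, (M.supplier j).prob (v j) (τ j) = 1 := by
      rw [← Fintype.prod_sum fun (j : AS) o => (M.supplier j).prob o (τ j)]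
      exact prod_eq_one fun j _ => (M.supplier j).sum_prob _
    calc _ ≤ ∑ u : AC → Option S, ∑ v : AS → Option C,
          (∏ i : AC, (M.customer i).prob (u i) (σ i)) *
            (∏ j : AS, (M.supplier j).prob (v j) (τ j)) * (Fintype.card C : ℝ) :=
          sum_le_sum fun u _ => sum_le_sum fun v _ =>
            mul_le_mul_of_nonneg_left (ih u v _ _).2 (mul_nonneg (hu u) (hv v))
      _ = Fintype.card C := by
          simp_rw [mul_assoc, ← mul_sum, ← sum_mul, hsv, one_mul, hsu]
          simp

theorem Market.bddAbove_expectedMatches (M : Market C S) (Q : Set (FullPolicy C S)) :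
    BddAbove (M.expectedMatches '' Q) := by
  refine ⟨Fintype.card C, ?_⟩
  rintro _ ⟨π, -, rfl⟩
  exact (π.value_mem_Icc M _ _).2

theorem Policy.exists_last {RC : Finset C} {RS : Finset S} (hC : RC = ∅) :
    ∃ π : Policy C S RC RS, π.CustomersFirstStatic ∧ π.CustomersFirstAdaptive ∧
      ∀ x y, π.OffersBacklog x y := by
  have key : ∀ {RC : Finset C} {RS : Finset S}, RC = ∅ → RS = ∅ →
      ∃ π : Policy C S RC RS, π.CustomersFirstStatic ∧ π.CustomersFirstAdaptive ∧
        ∀ x y, π.OffersBacklog x y := by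
    rintro _ _ rfl rfl
    exact ⟨done, by simp [CustomersFirstStatic], by simp [CustomersFirstAdaptive],
      by simp [OffersBacklog]⟩
  obtain ⟨π, h1, h2, h3⟩ := key (RC := RC \ ∅) (RS := RS \ RS) (by simp [hC]) (by simp)
  exact ⟨process ∅ RS (by simp) subset_rfl (fun _ => ∅) (fun _ => ∅) fun _ _ => π,
    by simp [CustomersFirstStatic, hC, h1], by simp [CustomersFirstAdaptive, hC, h2],
    by simp [OffersBacklog, h3]⟩

theorem oneSidedStatic_inter_backlogOnly_nonempty :
    (oneSidedStatic C S ∩ backlogOnly C S).Nonempty := by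
  obtain ⟨π, h1, -, h3⟩ := Policy.exists_last (C := C) (S := S) (RC := univ \ univ)
    (RS := univ \ ∅) (by simp)
  refine ⟨.process univ ∅ subset_rfl (by simp) (fun _ => ∅) (fun _ => ∅) fun _ _ => π,
    Or.inl ?_, ?_⟩
  · simp [Policy.CustomersFirstStatic, h1]
  · simp [backlogOnly, Policy.OffersBacklog, h3]

theorem oneSidedAdaptive_inter_backlogOnly_nonempty :
    (oneSidedAdaptive C S ∩ backlogOnly C S).Nonempty := by
  have key : ∀ (k : ℕ) (RC : Finset C) (RS : Finset S), #RC = k →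
      ∃ π : Policy C S RC RS, π.CustomersFirstAdaptive ∧ ∀ x y, π.OffersBacklog x y := by
    intro k
    induction k with
    | zero =>
      intro RC RS h
      obtain ⟨π, -, h2, h3⟩ := Policy.exists_last (RS := RS) (card_eq_zero.1 h)
      exact ⟨π, h2, h3⟩
    | succ k ih =>
      intro RC RS h
      obtain ⟨a, ha⟩ := card_pos.1 (show 0 < #RC by omega)
      have hs : {a} ⊆ RC := singleton_subset_iff.2 ha
      obtain ⟨π, h2, h3⟩ := ih (RC \ {a}) (RS \ ∅) (by rw [card_sdiff_of_subset hs, h]; simp)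
      exact ⟨.process {a} ∅ hs (by simp) (fun _ => ∅) (fun _ => ∅) fun _ _ => π,
        by simp [Policy.CustomersFirstAdaptive, h2], by simp [Policy.OffersBacklog, h3]⟩
  obtain ⟨π, h2, h3⟩ := key _ univ univ rfl
  exact ⟨π, Or.inl h2, h3 _ _⟩

end Sanity

end

/-!
The upper bound is a correlation gap. Randomization can be removed from a policy one node at a time,
and once one side, say the customers, has been processed, the best continuation offers to every
supplier its backlog, the set `B j` of customers who have chosen it: other customers in the offer are
excluded, or useless by substitutability (`Policy.value_le_of_customers_done`). A policy thus has the value `E ∑ j, f j (B j)`. In a policy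
that processes the customers one by one, let `w i T` be the probability that `i` is offered `T`
and `c i j` the resulting probability that `i` chooses `j`. By submodularity the value `V` satisfies
`V ≤ ∑ j, f j (R j) + ∑ i j, c i j * (f j (R j ∪ {i}) - f j (R j))` for all families of sets `R`
(`Policy.exists_offer_probabilities`). If instead every customer draws an assortment from `w i`
independently, and the choices are kept with probability `t`, let `H t` be the expected
value. Taking for `R` the random backlogs gives `H' ≥ V - H`, hence `H 1 ≥ (1 - 1/e) V`
(`Market.correlation_gap`), and some deterministic choice of the assortments is as good as the random
one. The other order follows by exchanging the two sides (`Policy.swap`).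

For the lower bound, consider `n` customers and `n` suppliers; a customer who is offered `k` suppliers
chooses each of them with probability `1 - exp (-1/k)`, and a supplier accepts a uniformly random
customer on offer (`extremalMarket`). If static offers are made to the customers, then the backlog
of a supplier `j` is empty with probability `exp (-d j)`, where `∑ j, d j ≤ n`, so the value is at
most `n (1 - 1/e)` by convexity (`extremalMarket.staticValue_le`); the same bound holds for offers
to the suppliers, since a customer matches with probability at most `k (1 - 1/e)` when `k` suppliers
have chosen it. Offering to the customers, one by one, the suppliers not chosen yet yields
`∑ s ≤ n, s (1 - exp (-1/s)) = n - o(n)`.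
-/

/-! ### The responding side -/

section Policies

-- The instance binders below are shared by all lemmas, although some need fewer.
set_option linter.unusedSectionVars false

variable {C S : Type*} [Fintype C] [Fintype S] [DecidableEq C] [DecidableEq S]

/-- The agents who have chosen `j`, when `x` records the choices made on the initiating side. -/
def backlog (x : C → Option S) (j : S) : Finset C := {i | x i = some j}

@[simp]
theorem mem_backlog {x : C → Option S} {j : S} {i : C} : i ∈ backlog x j ↔ x i = some j := by
  simp [backlog]

namespace ChoiceModel

variable {α : Type*} [DecidableEq α] {φ : ChoiceModel α}

theorem MonotoneSubmodular.demand_insert_sub_le (h : φ.MonotoneSubmodular) {E E' : Finset α}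
    (hE : E ⊆ E') (e : α) :
    φ.demand (insert e E') - φ.demand E' ≤ φ.demand (insert e E) - φ.demand E := by
  by_cases he : e ∈ E'
  · rw [insert_eq_of_mem he, sub_self, sub_nonneg]
    exact h.1 (subset_insert _ _)
  · exact h.2 E E' e hE he

/-- If the offer `T` consists of members of `B`, or if the model is substitutable, then the
probability that a member of `B` is chosen is at most what the offer `B` yields. -/
theorem sum_prob_le_demand (h : φ.MonotoneSubmodular) {B T : Finset α}
    (hT : φ.Substitutable ∨ T ⊆ B) : ∑ i ∈ B, φ.prob (some i) T ≤ φ.demand B := by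
  have h1 : ∑ i ∈ B, φ.prob (some i) T = ∑ i ∈ B ∩ T, φ.prob (some i) T :=
    (sum_subset inter_subset_left fun i hi hi' =>
      φ.prob_eq_zero i T fun hiT => hi' (mem_inter.2 ⟨hi, hiT⟩)).symm
  rw [h1]
  rcases hT with hT | hT
  · exact (hT _ _ inter_subset_right).trans (h.1 inter_subset_left)
  · rw [inter_eq_right.2 hT]
    exact h.1 hT

end ChoiceModel

/-- The expectation, over independent choices, of a function of one choice only. -/
theorem sum_prod_mul_apply {ι β : Type*} [Fintype ι] [DecidableEq ι] [Fintype β]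
    (c : ι → β → ℝ) (hc : ∀ i, ∑ o, c i o = 1) (i : ι) (h : β → ℝ) :
    ∑ v : ι → β, (∏ k, c k (v k)) * h (v i) = ∑ o, c i o * h o := by
  have h1 : ∀ v : ι → β, (∏ k, c k (v k)) * h (v i) =
      ∏ k, (c k (v k) * if k = i then h (v k) else 1) := fun v => by
    rw [prod_mul_distrib]
    congr 1
    rw [Fintype.prod_ite_eq' i fun k => h (v k)]
  simp_rw [h1]
  rw [← Fintype.prod_sum fun k o => c k o * if k = i then h o else 1, Fintype.prod_eq_single i]
  · simp
  · intro k hk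
    simp [hk, hc]

theorem sum_prod_eq_one {ι β : Type*} [Fintype ι] [DecidableEq ι] [Fintype β]
    (c : ι → β → ℝ) (hc : ∀ i, ∑ o, c i o = 1) : ∑ v : ι → β, ∏ k, c k (v k) = 1 := by
  rw [← Fintype.prod_sum]
  exact prod_eq_one fun i _ => hc i

/-- A weighted average does not exceed all the values. -/
theorem exists_le_of_sum_eq_one {ι : Type*} [Fintype ι] (w a : ι → ℝ) (h0 : ∀ i, 0 ≤ w i)
    (h1 : ∑ i, w i = 1) : ∃ i, ∑ k, w k * a k ≤ a i := by
  by_contra! h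
  have hne : ∃ i, 0 < w i := by
    by_contra! h'
    have : ∑ i, w i ≤ 0 := sum_nonpos fun i _ => h' i
    linarith
  obtain ⟨i, hi⟩ := hne
  have : ∑ k, w k * a k < ∑ k, w k * ∑ l, w l * a l :=
    sum_lt_sum (fun k _ => mul_le_mul_of_nonneg_left (h k).le (h0 k))
      ⟨i, mem_univ _, mul_lt_mul_of_pos_left (h i) hi⟩
  rw [← sum_mul, h1, one_mul] at this
  exact this.false

/-- Randomization can be removed: some branch of a random node is as good as the node. -/
theorem Policy.exists_value_random_le (M : Market C S) {RC : Finset C} {RS : Finset S} (p : PMF ℕ)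
    (next : ℕ → Policy C S RC RS) (x : C → Option S) (y : S → Option C) :
    ∃ k, (random p next).value M x y ≤ (next k).value M x y := by
  by_contra! h
  set V := (random p next).value M x y with hV
  have hp : HasSum (fun k => (p k).toReal) 1 := by
    have h := ENNReal.hasSum_toReal (f := fun k => p k) (by rw [p.tsum_coe]; simp)
    rwa [← ENNReal.tsum_toReal_eq fun k => p.apply_ne_top k, p.tsum_coe,
      ENNReal.toReal_one] at h
  have hs := hp.mul_right V
  have hle : ∀ k, (p k).toReal * (next k).value M x y ≤ (p k).toReal * V := fun k =>
    mul_le_mul_of_nonneg_left (h k).le ENNReal.toReal_nonneg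
  obtain ⟨k, hk⟩ := p.support_nonempty
  have hk' : 0 < (p k).toReal := ENNReal.toReal_pos ((p.mem_support_iff k).1 hk) (p.apply_ne_top k)
  have hsum := Summable.of_nonneg_of_le (fun k =>
    mul_nonneg ENNReal.toReal_nonneg ((next k).value_mem_Icc M x y).1) hle hs.summable
  have := hsum.tsum_lt_tsum hle (mul_lt_mul_of_pos_left (h k) hk') hs.summable
  rw [hs.tsum_eq, one_mul, hV, value] at this
  exact this.false

theorem record_apply_of_notMem {α β : Type*} [DecidableEq α] (x : α → Option β) {A : Finset α}
    (u : A → Option β) {a : α} (h : a ∉ A) : record x u a = x a := dif_neg h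

theorem record_apply_of_mem {α β : Type*} [DecidableEq α] (x : α → Option β) {A : Finset α}
    (u : A → Option β) {a : α} (h : a ∈ A) : record x u a = u ⟨a, h⟩ := dif_pos h

theorem record_empty {α β : Type*} [DecidableEq α] (x : α → Option β)
    (u : (∅ : Finset α) → Option β) : record x u = x :=
  funext fun _ => record_apply_of_notMem x u (notMem_empty _)

theorem record_singleton {α β : Type*} [DecidableEq α] (x : α → Option β) (a : α)
    (u : ({a} : Finset α) → Option β) :
    record x u = Function.update x a (u ⟨a, mem_singleton_self a⟩) := by
  funext b
  by_cases h : b = a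
  · subst h
    rw [record_apply_of_mem x u (mem_singleton_self b), Function.update_self]
  · rw [record_apply_of_notMem x u (by simpa using h), Function.update_of_ne h]

theorem matchCount_eq_sum (x : C → Option S) (y : S → Option C) :
    (matchCount x y : ℝ) = ∑ j, ∑ i ∈ backlog x j, if y j = some i then 1 else 0 := by
  unfold matchCount
  rw [card_filter, Fintype.sum_prod_type_right]
  push_cast
  refine sum_congr rfl fun j _ => ?_
  rw [backlog, sum_filter]
  refine sum_congr rfl fun i _ => ?_
  by_cases h : x i = some j <;> simp [h]

namespace Market

/-- The expected number of matches when the customers have chosen according to `x` and every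
supplier is offered its whole backlog. -/
noncomputable def responseValue (M : Market C S) (x : C → Option S) : ℝ :=
  ∑ j, (M.supplier j).demand (backlog x j)

/-- The value of the static policy that offers `σ i` to the customer `i`, and then to every
supplier its backlog. -/
noncomputable def staticValue (M : Market C S) (σ : C → Finset S) : ℝ :=
  ∑ x : C → Option S, (∏ i, (M.customer i).prob (x i) (σ i)) * M.responseValue x

end Market

namespace Policy

/-- The two settings under which a policy gains nothing by offering to responding agents others
than those who have chosen them. -/
def Restrained (M : Market C S) {RC : Finset C} {RS : Finset S} (π : Policy C S RC RS)
    (x : C → Option S) (y : S → Option C) : Prop :=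
  M.Substitutable ∨ π.OffersBacklog x y

theorem Restrained.random {M : Market C S} {RC : Finset C} {RS : Finset S} {p : PMF ℕ}
    {next : ℕ → Policy C S RC RS} {x : C → Option S} {y : S → Option C}
    (h : (random p next).Restrained M x y) (k : ℕ) : (next k).Restrained M x y :=
  h.imp_right fun h => by
    rw [OffersBacklog] at h
    exact h k

theorem Restrained.process {M : Market C S} {RC : Finset C} {RS : Finset S} {AC : Finset C}
    {AS : Finset S} {hAC : AC ⊆ RC} {hAS : AS ⊆ RS} {σ : AC → Finset S} {τ : AS → Finset C}
    {next : (AC → Option S) → (AS → Option C) → Policy C S (RC \ AC) (RS \ AS)}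
    {x : C → Option S} {y : S → Option C}
    (h : (process AC AS hAC hAS σ τ next).Restrained M x y) (u : AC → Option S)
    (v : AS → Option C) : (next u v).Restrained M (record x u) (record y v) :=
  h.imp_right fun h => by
    rw [OffersBacklog] at h
    exact h.2.2 u v

/-- Once the customers have been processed, a supplier that remains contributes at most its demand
at its backlog, whatever the order in which the suppliers are processed. -/
theorem value_le_of_customers_done {M : Market C S} (hM : M.MonotoneSubmodular)
    {RC : Finset C} {RS : Finset S} (π : Policy C S RC RS) (hRC : RC = ∅) (x : C → Option S)
    (y : S → Option C) (h : π.Restrained M x y) :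
    π.value M x y ≤ ∑ j, if j ∈ RS then (M.supplier j).demand (backlog x j) else
      ∑ i ∈ backlog x j, if y j = some i then 1 else 0 := by
  induction π generalizing x y with
  | done => simp [value, matchCount_eq_sum]
  | random p next ih =>
    obtain ⟨k, hk⟩ := exists_value_random_le M p next x y
    exact hk.trans (ih k hRC x y (h.random k))
  | @process RC RS AC AS hAC hAS σ τ next ih =>
    subst hRC
    obtain rfl : AC = ∅ := subset_empty.1 hAC
    have hone : ∀ j : AS, ∑ o, (M.supplier j).prob o (τ j) = 1 := fun j =>
      (M.supplier j).sum_prob _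
    rw [value, Fintype.sum_subsingleton _ fun _ => none]
    simp only [univ_eq_empty, prod_empty, one_mul]
    refine (sum_le_sum fun v _ => mul_le_mul_of_nonneg_left
      (ih _ v (by simp) _ _ (h.process _ v))
      (prod_nonneg fun (j : AS) _ => (M.supplier j).prob_nonneg (v j) (τ j))).trans ?_
    simp_rw [mul_sum]
    rw [sum_comm]
    refine sum_le_sum fun j _ => ?_
    rw [record_empty]
    by_cases hj : j ∈ AS
    · simp only [mem_sdiff, hj, not_true_eq_false, and_false, if_false, hAS hj, if_true,
        record_apply_of_mem _ _ hj]
      rw [sum_prod_mul_apply (fun (j : AS) o => (M.supplier j).prob o (τ j)) hone ⟨j, hj⟩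
        fun o => ∑ i ∈ backlog x j, if o = some i then (1 : ℝ) else 0]
      simp_rw [mul_sum]
      rw [sum_comm]
      simp only [mul_ite, mul_one, mul_zero, sum_ite_eq', mem_univ, if_true]
      refine ChoiceModel.sum_prob_le_demand (hM.2 j) (h.imp (fun h => h.2 j) fun h => ?_)
      rw [OffersBacklog] at h
      intro i hi
      rw [mem_backlog]
      exact h.1 rfl ⟨j, hj⟩ i hi
    · simp only [mem_sdiff, hj, not_false_eq_true, and_true, record_apply_of_notMem _ _ hj]
      rw [← sum_mul, sum_prod_eq_one (fun (j : AS) o => (M.supplier j).prob o (τ j)) hone, one_mul]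

theorem value_le_responseValue {M : Market C S} (hM : M.MonotoneSubmodular)
    {RC : Finset C} {RS : Finset S} (π : Policy C S RC RS) (hRC : RC = ∅) (hRS : RS = univ)
    (x : C → Option S) (y : S → Option C) (h : π.Restrained M x y) :
    π.value M x y ≤ M.responseValue x := by
  have := value_le_of_customers_done hM π hRC x y h
  simpa [hRS, Market.responseValue] using this

/-- The bound `value_le_responseValue` is attained, by offering to every supplier its backlog. -/
theorem exists_value_eq_responseValue (M : Market C S) {RC : Finset C} {RS : Finset S}
    (hRC : RC = ∅) (hRS : RS = univ) (x : C → Option S) :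
    ∃ π : Policy C S RC RS, π.CustomersFirstStatic ∧ π.CustomersFirstAdaptive ∧
      (∀ y, π.OffersBacklog x y) ∧ ∀ y, π.value M x y = M.responseValue x := by
  subst hRC hRS
  have hdone : ∀ {RC : Finset C} {RS : Finset S}, RC = ∅ → RS = ∅ →
      ∃ π : Policy C S RC RS, π.CustomersFirstStatic ∧ π.CustomersFirstAdaptive ∧
        (∀ x y, π.OffersBacklog x y) ∧ ∀ x y, π.value M x y = matchCount x y := by
    rintro _ _ rfl rfl
    exact ⟨done, by simp [CustomersFirstStatic], by simp [CustomersFirstAdaptive],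
      by simp [OffersBacklog], by simp [value]⟩
  obtain ⟨π, h1, h2, h3, h4⟩ := hdone (RC := ∅ \ ∅) (RS := univ \ univ) (by simp) (by simp)
  refine ⟨process ∅ univ (by simp) subset_rfl (fun _ => ∅) (fun j => backlog x j) fun _ _ => π,
    by simp [CustomersFirstStatic, h1], by simp [CustomersFirstAdaptive, h2], fun y => ?_,
    fun y => ?_⟩
  · rw [OffersBacklog]
    refine ⟨fun _ j i hi => mem_backlog.1 hi, fun hS i => ?_, fun u v => h3 _ _⟩
    exact absurd i.2 (notMem_empty _)
  · rw [value, Fintype.sum_subsingleton _ fun _ => none]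
    simp only [univ_eq_empty, prod_empty, one_mul, h4, record_empty, matchCount_eq_sum]
    simp_rw [mul_sum]
    rw [sum_comm]
    refine sum_congr rfl fun j _ => ?_
    have hj := mem_univ j
    simp only [record_apply_of_mem _ _ hj, ← mul_sum]
    rw [sum_prod_mul_apply (fun (j : (univ : Finset S)) o =>
        (M.supplier j).prob o (backlog x j.1)) (fun j => (M.supplier j).sum_prob _) ⟨j, hj⟩
        fun o => ∑ i ∈ backlog x j, if o = some i then (1 : ℝ) else 0]
    simp_rw [mul_sum]
    rw [sum_comm]
    simp [ChoiceModel.demand]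

end Policy

/-! ### Customers first: adaptive and static policies -/

namespace Policy

theorem value_process_singleton (M : Market C S) {RC : Finset C} {RS : Finset S} (a : C)
    (ha : {a} ⊆ RC) (hAS : ∅ ⊆ RS) (σ : ({a} : Finset C) → Finset S)
    (τ : (∅ : Finset S) → Finset C)
    (next : (({a} : Finset C) → Option S) → ((∅ : Finset S) → Option C) →
      Policy C S (RC \ {a}) (RS \ ∅)) (x : C → Option S) (y : S → Option C) :
    (process {a} ∅ ha hAS σ τ next).value M x y =
      ∑ o, (M.customer a).prob o (σ ⟨a, mem_singleton_self a⟩) *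
        (next (fun _ => o) (fun _ => none)).value M (Function.update x a o) y := by
  rw [value]
  refine Fintype.sum_equiv (Equiv.funUnique ({a} : Finset C) (Option S)) _ _ fun u => ?_
  obtain ⟨o, rfl⟩ : ∃ o, u = fun _ => o :=
    ⟨u ⟨a, mem_singleton_self a⟩, funext fun i => congrArg u (Subsingleton.elim _ _)⟩
  rw [Fintype.sum_subsingleton _ fun _ => none, Fintype.prod_unique]
  simp only [univ_eq_empty, prod_empty, mul_one, record_empty, record_singleton]
  rfl

theorem backlog_update_sdiff {RC : Finset C} {a : C} (ha : a ∈ RC) (x : C → Option S)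
    (o : Option S) (j : S) :
    backlog (Function.update x a o) j \ (RC \ {a}) =
      if o = some j then insert a (backlog x j \ RC) else backlog x j \ RC := by
  ext i
  by_cases hi : i = a
  · subst hi
    split_ifs with ho <;> simp [ho, ha]
  · split_ifs with ho <;> simp [hi]

/-- A policy that processes the customers one by one offers to the customer `i` the assortment `T`
with some probability `w i T`. Only these probabilities matter for the following bound: whatever
sets `R j` of customers are given, submodularity bounds the value by what the sets `R j` yield
plus the sum of the marginal contributions to them, weighted by the probability that `i`
chooses `j`. At a random node `w` describes the a branch at least as good as the average. (Here `x` records the choices of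
the customers outside `RC`.) -/
theorem exists_offer_probabilities {M : Market C S} (hM : M.MonotoneSubmodular)
    {RC : Finset C} {RS : Finset S} (π : Policy C S RC RS) (hRS : RS = univ)
    (hπ : π.CustomersFirstAdaptive) (x : C → Option S) (y : S → Option C)
    (h : π.Restrained M x y) :
    ∃ w : C → Finset S → ℝ, (∀ i T, 0 ≤ w i T) ∧ (∀ i, ∑ T, w i T = 1) ∧
      ∀ R : S → Finset C, π.value M x y ≤
        ∑ j, (M.supplier j).demand (R j ∪ (backlog x j \ RC)) +
        ∑ i ∈ RC, ∑ j, (∑ T, w i T * (M.customer i).prob (some j) T) *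
          ((M.supplier j).demand (insert i (R j)) - (M.supplier j).demand (R j)) := by
  -- Once no customer remains, the second sum is empty, and `w` does not matter.
  have hlast : ∀ {RC : Finset C} {RS : Finset S} (π : Policy C S RC RS) (x : C → Option S)
      (y : S → Option C), RC = ∅ → RS = univ → π.Restrained M x y →
      ∃ w : C → Finset S → ℝ, (∀ i T, 0 ≤ w i T) ∧ (∀ i, ∑ T, w i T = 1) ∧
        ∀ R : S → Finset C, π.value M x y ≤
          ∑ j, (M.supplier j).demand (R j ∪ (backlog x j \ RC)) +
          ∑ i ∈ RC, ∑ j, (∑ T, w i T * (M.customer i).prob (some j) T) *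
            ((M.supplier j).demand (insert i (R j)) - (M.supplier j).demand (R j)) := by
    intro RC RS π x y hRC hRS h
    refine ⟨fun _ T => if T = ∅ then 1 else 0, fun i T => by positivity, by simp, fun R => ?_⟩
    refine (value_le_responseValue hM π hRC hRS x y h).trans ?_
    subst hRC
    rw [sum_empty, add_zero]
    exact sum_le_sum fun j _ => (hM.2 j).1 (by simp)
  induction π generalizing x y with
  | done => exact hlast _ x y rfl hRS h
  | random p next ih =>
    obtain ⟨k, hk⟩ := exists_value_random_le M p next x y
    rw [CustomersFirstAdaptive] at hπ
    obtain ⟨w, h0, h1, hw⟩ := ih k hRS (hπ k) x y (h.random k)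
    exact ⟨w, h0, h1, fun R => hk.trans (hw R)⟩
  | @process RC RS AC AS hAC hAS σ τ next ih =>
    rcases eq_or_ne RC ∅ with hRC | hRC
    · exact hlast _ x y hRC hRS h
    have hπ' := hπ
    rw [CustomersFirstAdaptive] at hπ'
    obtain ⟨⟨hcard, rfl⟩, hnext⟩ := And.imp_left (fun h => h hRC) hπ'
    obtain ⟨a, rfl⟩ := card_eq_one.1 hcard
    have ha : a ∈ RC := singleton_subset_iff.1 hAC
    have hR : ∀ o : Option S,
        (next (fun _ => o) fun _ => none).Restrained M (Function.update x a o) y :=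
      fun o => by
        have := h.process (fun _ => o) (fun _ => none)
        rwa [record_singleton, record_empty] at this
    choose w h0 h1 hw using fun o : Option S => ih (fun _ => o) (fun _ => none) (by simp [hRS])
      (hnext _ _) (Function.update x a o) y (hR o)
    -- The customer `a` is certain to be offered `A`; the others are treated according to the choice `o`
    -- of `a`.
    set A := σ ⟨a, mem_singleton_self a⟩ with hA
    have hp : ∀ o, 0 ≤ (M.customer a).prob o A := fun o => (M.customer a).prob_nonneg o A
    refine ⟨fun i T => if i = a then if T = A then 1 else 0 else
      ∑ o, (M.customer a).prob o A * w o i T, fun i T => ?_, fun i => ?_, fun R => ?_⟩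
    · beta_reduce
      split_ifs
      · exact zero_le_one
      · exact le_rfl
      · exact sum_nonneg fun o _ => mul_nonneg (hp o) (h0 o i T)
    · beta_reduce
      split_ifs
      · simp
      · rw [sum_comm]
        simp_rw [← mul_sum, h1, mul_one]
        exact (M.customer a).sum_prob A
    · rw [value_process_singleton]
      set Δ : C → S → ℝ := fun i j =>
        (M.supplier j).demand (insert i (R j)) - (M.supplier j).demand (R j) with hΔ
      set B : S → Finset C := fun j => R j ∪ (backlog x j \ RC) with hB
      have hstep : ∀ o : Option S,
          ∑ j, (M.supplier j).demand (R j ∪ (backlog (Function.update x a o) j \ (RC \ {a}))) ≤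
            ∑ j, (M.supplier j).demand (B j) + ∑ j, if o = some j then Δ a j else 0 := fun o => by
        rw [← sum_add_distrib]
        refine sum_le_sum fun j _ => ?_
        rw [backlog_update_sdiff ha]
        split_ifs with ho
        · rw [union_insert]
          have := (hM.2 j).demand_insert_sub_le (subset_union_left : R j ⊆ B j) a
          simp only [hB, hΔ] at this ⊢
          linarith
        · rw [add_zero]
      calc _ ≤ ∑ o, (M.customer a).prob o A *
            ((∑ j, (M.supplier j).demand (B j) + ∑ j, if o = some j then Δ a j else 0) +
              ∑ i ∈ RC \ {a}, ∑ j, (∑ T, w o i T * (M.customer i).prob (some j) T) * Δ i j) :=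
            sum_le_sum fun o _ => mul_le_mul_of_nonneg_left
              ((hw o R).trans (add_le_add_left (hstep o) _)) (hp o)
        _ = ∑ j, (M.supplier j).demand (B j) +
            (∑ j, (M.customer a).prob (some j) A * Δ a j +
              ∑ i ∈ RC \ {a}, ∑ j, (∑ T, (∑ o, (M.customer a).prob o A * w o i T) *
                (M.customer i).prob (some j) T) * Δ i j) := by
            simp_rw [mul_add, sum_add_distrib]
            rw [← sum_mul, (M.customer a).sum_prob A, one_mul, add_assoc]
            congr 2
            · simp_rw [mul_sum]
              rw [sum_comm]
              simp
            · simp_rw [mul_sum, sum_mul]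
              rw [sum_comm]
              refine sum_congr rfl fun i _ => ?_
              rw [sum_comm]
              refine sum_congr rfl fun j _ => ?_
              simp only [mul_sum]
              rw [sum_comm]
              refine sum_congr rfl fun T _ => sum_congr rfl fun o _ => ?_
              ring
        _ = _ := by
            congr 1
            rw [← add_sum_erase _ _ ha, sdiff_singleton_eq_erase]
            congr 1
            · simp [hΔ]
            · refine sum_congr rfl fun i hi => ?_
              simp [hΔ, ne_of_mem_erase hi]

theorem value_process_univ (M : Market C S) {RC : Finset C} {RS : Finset S}
    (hRC : univ ⊆ RC) (hAS : ∅ ⊆ RS) (σ : ↥(univ : Finset C) → Finset S)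
    (τ : (∅ : Finset S) → Finset C)
    (next : (↥(univ : Finset C) → Option S) → ((∅ : Finset S) → Option C) →
      Policy C S (RC \ univ) (RS \ ∅)) (x : C → Option S) (y : S → Option C) :
    (process univ ∅ hRC hAS σ τ next).value M x y =
      ∑ z : C → Option S, (∏ i, (M.customer i).prob (z i) (σ ⟨i, mem_univ i⟩)) *
        (next (fun i => z i) (fun _ => none)).value M z y := by
  rw [value]
  refine Fintype.sum_equiv (Equiv.arrowCongr (Equiv.subtypeUnivEquiv mem_univ)
    (Equiv.refl (Option S))) _ _ fun u => ?_
  rw [Fintype.sum_subsingleton _ fun _ => none]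
  simp only [univ_eq_empty, prod_empty, mul_one, record_empty]
  congr 1
  · exact Fintype.prod_equiv (Equiv.subtypeUnivEquiv mem_univ) _ _ fun i => rfl
  · congr 1
    funext i
    exact record_apply_of_mem _ _ (mem_univ i)

theorem value_le_of_customersFirstStatic [Nonempty C] {M : Market C S} (hM : M.MonotoneSubmodular)
    {K : ℝ} (hK : ∀ σ, M.staticValue σ ≤ K) {RC : Finset C} {RS : Finset S}
    (π : Policy C S RC RS) (hRC : RC = univ) (hRS : RS = univ) (hπ : π.CustomersFirstStatic)
    (x : C → Option S) (y : S → Option C) (h : π.Restrained M x y) : π.value M x y ≤ K := by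
  induction π generalizing x y with
  | done => exact absurd hRC.symm univ_nonempty.ne_empty
  | random p next ih =>
    obtain ⟨k, hk⟩ := exists_value_random_le M p next x y
    rw [CustomersFirstStatic] at hπ
    exact hk.trans (ih k hRC hRS (hπ k) x y (h.random k))
  | @process RC RS AC AS hAC hAS σ τ next ih =>
    clear ih
    have hπ' := hπ
    rw [CustomersFirstStatic] at hπ'
    obtain ⟨rfl, rfl⟩ := hπ'.1 (hRC ▸ univ_nonempty.ne_empty)
    subst hRC
    rw [value_process_univ]
    refine le_trans (sum_le_sum fun z _ => ?_) (hK fun i => σ ⟨i, mem_univ i⟩)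
    refine mul_le_mul_of_nonneg_left ?_ (prod_nonneg fun i _ => (M.customer i).prob_nonneg _ _)
    refine value_le_responseValue hM _ (by simp) (by simp [hRS]) z y ?_
    have := h.process (fun i => z i) (fun _ => none)
    rwa [record_empty, show (record x fun i : ↥(univ : Finset C) => z i) = z from
      funext fun i => record_apply_of_mem _ _ (mem_univ i)] at this

theorem exists_value_eq_staticValue (M : Market C S) (σ : C → Finset S) :
    ∃ π : FullPolicy C S, π.CustomersFirstStatic ∧ π ∈ backlogOnly C S ∧
      M.expectedMatches π = M.staticValue σ := by
  choose π h1 _ h3 h4 using fun z : C → Option S => exists_value_eq_responseValue M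
    (RC := univ \ univ) (RS := univ \ ∅) (by simp) (by simp) z
  refine ⟨.process univ ∅ subset_rfl (by simp) (fun i => σ i) (fun _ => ∅) fun u _ =>
    π (record (fun _ => none) u), ?_, ?_, ?_⟩
  · rw [CustomersFirstStatic]
    exact ⟨fun _ => ⟨rfl, rfl⟩, fun u v => h1 _⟩
  · rw [backlogOnly, Set.mem_ofPred_eq, OffersBacklog]
    exact ⟨fun _ j => absurd j.2 (notMem_empty _),
      fun hS i j => absurd (mem_univ j) (hS ▸ notMem_empty j),
      fun u v => h3 _ _⟩
  · rw [Market.expectedMatches, value_process_univ, Market.staticValue]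
    refine sum_congr rfl fun z _ => ?_
    rw [show (record (fun _ => none) fun i : ↥(univ : Finset C) => z i) = z from
      funext fun i => record_apply_of_mem _ _ (mem_univ i), h4]

end Policy

/-! ### The correlation gap -/

/-- Resampling one coordinate: integrating against signed weights `b` in place of the probabilities
`c i` in the coordinate `i` amounts to averaging, over all configurations, the integral
along `i`. -/
theorem sum_prod_erase_mul {ι β : Type*} [Fintype ι] [DecidableEq ι] [Fintype β]
    (c : ι → β → ℝ) (i : ι) (hc : ∑ o, c i o = 1) (b : β → ℝ) (K : (ι → β) → ℝ) :
    ∑ x : ι → β, (∏ k ∈ univ.erase i, c k (x k)) * b (x i) * K x =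
      ∑ x : ι → β, (∏ k, c k (x k)) * ∑ o, b o * K (Function.update x i o) := by
  have h1 : ∀ (x : ι → β) (o : β), ∏ k ∈ univ.erase i, c k (Function.update x i o k) =
      ∏ k ∈ univ.erase i, c k (x k) := fun x o =>
    prod_congr rfl fun k hk => by rw [Function.update_of_ne (ne_of_mem_erase hk)]
  calc _ = ∑ x : ι → β, ∑ o, c i o * ((∏ k ∈ univ.erase i, c k (x k)) * b (x i) * K x) := by
        simp_rw [← sum_mul, hc, one_mul]
    _ = ∑ q : (ι → β) × β, c i q.2 *
          ((∏ k ∈ univ.erase i, c k (q.1 k)) * b (q.1 i) * K q.1) := by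
        rw [Fintype.sum_prod_type]
    _ = ∑ q : (ι → β) × β, c i (q.1 i) * ((∏ k ∈ univ.erase i, c k (q.1 k)) * b q.2 *
          K (Function.update q.1 i q.2)) := by
        refine Finset.sum_nbij' (fun q => (Function.update q.1 i q.2, q.1 i))
          (fun q => (Function.update q.1 i q.2, q.1 i)) (fun _ _ => mem_univ _)
          (fun _ _ => mem_univ _) (fun q _ => by simp) (fun q _ => by simp) fun q _ => ?_
        simp [h1]
    _ = _ := by
        rw [Fintype.sum_prod_type]
        refine sum_congr rfl fun x _ => ?_
        rw [mul_sum, ← mul_prod_erase univ (fun k => c k (x k)) (mem_univ i)]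
        exact sum_congr rfl fun o _ => by ring

/-- The probability weights of the choices when every customer is, independently, with
probability `t` directed to choose with the probabilities `c` and otherwise chooses nobody. -/
noncomputable def thinned (c : C → Option S → ℝ) (t : ℝ) (i : C) (o : Option S) : ℝ :=
  (1 - t) * (if o = none then 1 else 0) + t * c i o

theorem sum_thinned {c : C → Option S → ℝ} (hc : ∀ i, ∑ o, c i o = 1) (t : ℝ) (i : C) :
    ∑ o, thinned c t i o = 1 := by
  simp [thinned, sum_add_distrib, ← mul_sum, hc]

theorem thinned_nonneg {c : C → Option S → ℝ} (h0 : ∀ i o, 0 ≤ c i o) {t : ℝ} (ht : 0 ≤ t)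
    (ht1 : t ≤ 1) (i : C) (o : Option S) : 0 ≤ thinned c t i o := by
  have := sub_nonneg.2 ht1
  have := h0 i o
  unfold thinned
  positivity

theorem hasDerivAt_sum_prod_thinned {c : C → Option S → ℝ} (hc : ∀ i, ∑ o, c i o = 1)
    (G : (C → Option S) → ℝ) (t : ℝ) :
    HasDerivAt (fun t => ∑ x : C → Option S, (∏ i, thinned c t i (x i)) * G x)
      (∑ x : C → Option S, (∏ i, thinned c t i (x i)) * ∑ i, ∑ j,
        c i (some j) * (G (Function.update x i (some j)) - G (Function.update x i none))) t := by
  have h1 : ∀ i o, HasDerivAt (fun t => thinned c t i o) (c i o - if o = none then 1 else 0) t :=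
    fun i o => by
      have := (((hasDerivAt_id t).const_sub 1).mul_const (if o = none then (1 : ℝ) else 0)).add
        ((hasDerivAt_id t).mul_const (c i o))
      exact this.congr_deriv (by ring)
  have h2 := HasDerivAt.fun_sum (u := univ) fun (x : C → Option S) _ =>
    (HasDerivAt.fun_finsetProd (u := univ) fun i _ => h1 i (x i)).mul_const (G x)
  refine h2.congr_deriv ?_
  simp only [sum_mul, smul_eq_mul]
  simp_rw [mul_sum]
  rw [sum_comm, sum_comm (s := univ (α := C → Option S)) (t := univ (α := C))]
  refine sum_congr rfl fun i _ => ?_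
  rw [sum_prod_erase_mul (fun k o => thinned c t k o) i (sum_thinned hc t i)
    (fun o => c i o - if o = none then 1 else 0) G]
  refine sum_congr rfl fun x _ => ?_
  rw [← mul_sum]
  congr 1
  have h3 := hc i
  rw [Fintype.sum_option] at h3
  rw [Fintype.sum_option]
  simp only [if_true, reduceCtorEq, if_false, sub_zero, mul_sub, sum_sub_distrib, ← sum_mul]
  rw [eq_sub_of_add_eq' h3]
  ring

theorem backlog_update_some (x : C → Option S) (i : C) (j j' : S) :
    backlog (Function.update x i (some j)) j' =
      if j' = j then insert i (backlog (Function.update x i none) j')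
      else backlog (Function.update x i none) j' := by
  ext k
  by_cases hk : k = i
  · subst hk
    split_ifs with h <;> simp [h]
    exact fun h' => h h'.symm
  · split_ifs with h <;> simp [hk]

namespace Market

theorem responseValue_update_sub (M : Market C S) (x : C → Option S) (i : C) (j : S) :
    M.responseValue (Function.update x i (some j)) - M.responseValue (Function.update x i none) =
      (M.supplier j).demand (insert i (backlog (Function.update x i none) j)) -
        (M.supplier j).demand (backlog (Function.update x i none) j) := by
  unfold responseValue
  rw [← sum_sub_distrib, Fintype.sum_eq_single j]
  · rw [backlog_update_some, if_pos rfl]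
  · intro j' hj'
    rw [backlog_update_some, if_neg hj', sub_self]

/-- The correlation gap. If `V` is at most what arbitrary sets `R j` yield plus the sum of the
marginal contributions to them, weighted by the probabilities `c`, then independent choices with
the probabilities `c` yield at least `(1 - 1/e) V`: along the thinned choices, the value `H`
satisfies `H' ≥ V - H`. -/
theorem correlation_gap {M : Market C S} (hM : M.MonotoneSubmodular) {c : C → Option S → ℝ}
    (h0 : ∀ i o, 0 ≤ c i o) (h1 : ∀ i, ∑ o, c i o = 1) {V : ℝ}
    (hV : ∀ R : S → Finset C, V ≤ ∑ j, (M.supplier j).demand (R j) + ∑ i, ∑ j, c i (some j) *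
      ((M.supplier j).demand (insert i (R j)) - (M.supplier j).demand (R j))) :
    (1 - Real.exp (-1)) * V ≤ ∑ x : C → Option S, (∏ i, c i (x i)) * M.responseValue x := by
  set H : ℝ → ℝ := fun t =>
    ∑ x : C → Option S, (∏ i, thinned c t i (x i)) * M.responseValue x with hH
  set H' : ℝ → ℝ := fun t => ∑ x : C → Option S, (∏ i, thinned c t i (x i)) * ∑ i, ∑ j,
    c i (some j) * (M.responseValue (Function.update x i (some j)) -
      M.responseValue (Function.update x i none)) with hH'
  have hderiv : ∀ t, HasDerivAt H (H' t) t := fun t =>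
    hasDerivAt_sum_prod_thinned h1 M.responseValue t
  have hle : ∀ t, 0 ≤ t → t ≤ 1 → V - H t ≤ H' t := by
    intro t ht ht1
    have hsum : ∑ x : C → Option S, ∏ i, thinned c t i (x i) = 1 :=
      sum_prod_eq_one _ (sum_thinned h1 t)
    have hVs : V = ∑ x : C → Option S, (∏ i, thinned c t i (x i)) * V := by
      rw [← sum_mul, hsum, one_mul]
    rw [hVs, hH, ← sum_sub_distrib]
    refine sum_le_sum fun x _ => ?_
    rw [← mul_sub]
    refine mul_le_mul_of_nonneg_left ?_ (prod_nonneg fun i _ => thinned_nonneg h0 ht ht1 i _)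
    refine (sub_le_iff_le_add'.2 (hV fun j => backlog x j)).trans ?_
    refine sum_le_sum fun i _ => sum_le_sum fun j _ =>
      mul_le_mul_of_nonneg_left ?_ (h0 i _)
    rw [responseValue_update_sub]
    refine (hM.2 j).demand_insert_sub_le (fun k hk => ?_) i
    rw [mem_backlog] at hk ⊢
    by_cases hki : k = i
    · subst hki
      simp at hk
    · rwa [Function.update_of_ne hki] at hk
  have hexp : ∀ t, HasDerivAt (fun t => Real.exp t * (H t - V))
      (Real.exp t * (H t - V) + Real.exp t * H' t) t := fun t =>
    (Real.hasDerivAt_exp t).mul ((hderiv t).sub_const V)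
  have hmono : MonotoneOn (fun t => Real.exp t * (H t - V)) (Set.Icc 0 1) := by
    refine monotoneOn_of_deriv_nonneg (convex_Icc 0 1)
      (fun t _ => (hexp t).continuousAt.continuousWithinAt)
      (fun t _ => (hexp t).differentiableAt.differentiableWithinAt) fun t ht => ?_
    rw [interior_Icc] at ht
    rw [(hexp t).deriv, ← mul_add]
    have := hle t ht.1.le ht.2.le
    exact mul_nonneg (Real.exp_pos t).le (by linarith)
  have h01 := hmono (Set.left_mem_Icc.2 zero_le_one) (Set.right_mem_Icc.2 zero_le_one) zero_le_one
  have hH0 : 0 ≤ H 0 := by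
    refine sum_nonneg fun x _ => mul_nonneg
      (prod_nonneg fun i _ => thinned_nonneg h0 le_rfl zero_le_one i _) (sum_nonneg fun j _ => ?_)
    exact sum_nonneg fun i _ => (M.supplier j).prob_nonneg _ _
  have hH1 : H 1 = ∑ x : C → Option S, (∏ i, c i (x i)) * M.responseValue x := by
    simp [hH, thinned]
  rw [← hH1]
  simp only [Real.exp_zero, one_mul] at h01
  have h2 : Real.exp (-1) * (H 0 - V) ≤ H 1 - V := by
    have := mul_le_mul_of_nonneg_left h01 (Real.exp_pos (-1)).le
    rwa [← mul_assoc, ← Real.exp_add, neg_add_cancel, Real.exp_zero, one_mul] at this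
  have h3 := mul_nonneg (Real.exp_pos (-1)).le hH0
  linarith

/-- Independent random assortments do not beat the best deterministic ones. -/
theorem exists_le_staticValue (M : Market C S) (w : C → Finset S → ℝ) (h0 : ∀ i T, 0 ≤ w i T)
    (h1 : ∀ i, ∑ T, w i T = 1) :
    ∃ σ, ∑ x : C → Option S, (∏ i, ∑ T, w i T * (M.customer i).prob (x i) T) * M.responseValue x ≤
      M.staticValue σ := by
  obtain ⟨σ, hσ⟩ := exists_le_of_sum_eq_one (fun σ : C → Finset S => ∏ i, w i (σ i)) M.staticValue
    (fun σ => prod_nonneg fun i _ => h0 i _) (sum_prod_eq_one w h1)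
  refine ⟨σ, le_of_eq_of_le ?_ hσ⟩
  simp_rw [staticValue, mul_sum]
  rw [sum_comm]
  refine sum_congr rfl fun x _ => ?_
  rw [Fintype.prod_sum fun i T => w i T * (M.customer i).prob (x i) T, sum_mul]
  exact sum_congr rfl fun σ _ => by rw [prod_mul_distrib, mul_assoc]

end Market

/-! ### Exchanging the two sides -/

/-- The market in which customers and suppliers have exchanged their roles. -/
def Market.swap (M : Market C S) : Market S C := ⟨M.supplier, M.customer⟩

theorem matchCount_swap (x : C → Option S) (y : S → Option C) : matchCount y x = matchCount x y :=
  card_equiv (Equiv.prodComm S C) fun q => by simp [and_comm]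

namespace Policy

/-- The same policy, when customers and suppliers have exchanged their roles. -/
def swap : {RC : Finset C} → {RS : Finset S} → Policy C S RC RS → Policy S C RS RC
  | _, _, done => done
  | _, _, random p next => random p fun k => (next k).swap
  | _, _, process AC AS hAC hAS σ τ next =>
      process AS AC hAS hAC τ σ fun v u => (next u v).swap

variable {RC : Finset C} {RS : Finset S}

theorem value_swap (M : Market C S) (π : Policy C S RC RS) (x : C → Option S)
    (y : S → Option C) : π.swap.value M.swap y x = π.value M x y := by
  induction π generalizing x y with
  | done =>
    rw [swap, value, value, matchCount_swap]
  | random p next ih => simp [swap, value, ih]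
  | process AC AS hAC hAS σ τ next ih =>
    rw [swap, value, value, sum_comm]
    refine sum_congr rfl fun u _ => sum_congr rfl fun v _ => ?_
    rw [ih, mul_comm (∏ i : AS, _)]
    rfl

theorem customersFirstStatic_swap (π : Policy C S RC RS) :
    π.swap.CustomersFirstStatic ↔ π.SuppliersFirstStatic := by
  induction π with
  | done => simp [swap, CustomersFirstStatic, SuppliersFirstStatic]
  | random p next ih => simp [swap, CustomersFirstStatic, SuppliersFirstStatic, ih]
  | process AC AS hAC hAS σ τ next ih =>
    simp only [swap, CustomersFirstStatic, SuppliersFirstStatic, ih]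
    exact and_congr_right fun _ => forall_comm

theorem suppliersFirstStatic_swap (π : Policy C S RC RS) :
    π.swap.SuppliersFirstStatic ↔ π.CustomersFirstStatic := by
  induction π with
  | done => simp [swap, CustomersFirstStatic, SuppliersFirstStatic]
  | random p next ih => simp [swap, CustomersFirstStatic, SuppliersFirstStatic, ih]
  | process AC AS hAC hAS σ τ next ih =>
    simp only [swap, CustomersFirstStatic, SuppliersFirstStatic, ih]
    exact and_congr_right fun _ => forall_comm

theorem customersFirstAdaptive_swap (π : Policy C S RC RS) :
    π.swap.CustomersFirstAdaptive ↔ π.SuppliersFirstAdaptive := by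
  induction π with
  | done => simp [swap, CustomersFirstAdaptive, SuppliersFirstAdaptive]
  | random p next ih => simp [swap, CustomersFirstAdaptive, SuppliersFirstAdaptive, ih]
  | process AC AS hAC hAS σ τ next ih =>
    simp only [swap, CustomersFirstAdaptive, SuppliersFirstAdaptive, ih]
    exact and_congr_right fun _ => forall_comm

theorem offersBacklog_swap (π : Policy C S RC RS) (x : C → Option S) (y : S → Option C) :
    π.swap.OffersBacklog y x ↔ π.OffersBacklog x y := by
  induction π generalizing x y with
  | done => simp [swap, OffersBacklog]
  | random p next ih => simp [swap, OffersBacklog, ih]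
  | process AC AS hAC hAS σ τ next ih =>
    simp only [swap, OffersBacklog, ih]
    rw [and_left_comm]
    exact and_congr_right fun _ => and_congr_right fun _ => forall_comm

theorem Restrained.swap {M : Market C S} {π : Policy C S RC RS} {x : C → Option S}
    {y : S → Option C} (h : π.Restrained M x y) : π.swap.Restrained M.swap y x :=
  h.imp And.symm (offersBacklog_swap π x y).2

end Policy

/-! ### The adaptivity gap is at most `e / (e - 1)` -/

namespace Market

theorem MonotoneSubmodular.swap {M : Market C S} (hM : M.MonotoneSubmodular) :
    M.swap.MonotoneSubmodular := And.symm hM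

theorem expectedMatches_swap (M : Market C S) (π : FullPolicy C S) :
    M.swap.expectedMatches π.swap = M.expectedMatches π :=
  π.value_swap M _ _

theorem expectedMatches_le_opt (M : Market C S) {Q : Set (FullPolicy C S)} {π : FullPolicy C S}
    (h : π ∈ Q) : M.expectedMatches π ≤ M.opt Q :=
  le_csSup (M.bddAbove_expectedMatches Q) ⟨π, h, rfl⟩

theorem opt_le (M : Market C S) {Q : Set (FullPolicy C S)} (hQ : Q.Nonempty) {K : ℝ}
    (h : ∀ π ∈ Q, M.expectedMatches π ≤ K) : M.opt Q ≤ K :=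
  csSup_le (hQ.image _) (by rintro _ ⟨π, hπ, rfl⟩; exact h π hπ)

theorem opt_mono (M : Market C S) {Q Q' : Set (FullPolicy C S)} (hQ : Q.Nonempty) (h : Q ⊆ Q') :
    M.opt Q ≤ M.opt Q' :=
  M.opt_le hQ fun _ hπ => M.expectedMatches_le_opt (h hπ)

theorem staticValue_le_optOSBacklog (M : Market C S) (σ : C → Finset S) :
    M.staticValue σ ≤ M.optOSBacklog := by
  obtain ⟨π, h1, h2, h3⟩ := Policy.exists_value_eq_staticValue M σ
  exact h3 ▸ M.expectedMatches_le_opt ⟨Or.inl h1, h2⟩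

theorem staticValue_swap_le_optOSBacklog (M : Market C S) (τ : S → Finset C) :
    M.swap.staticValue τ ≤ M.optOSBacklog := by
  obtain ⟨π, h1, h2, h3⟩ := Policy.exists_value_eq_staticValue M.swap τ
  have h4 : M.expectedMatches π.swap = M.swap.expectedMatches π := M.swap.expectedMatches_swap π
  rw [← h3, ← h4]
  exact M.expectedMatches_le_opt
    ⟨Or.inr (π.suppliersFirstStatic_swap.2 h1), (π.offersBacklog_swap _ _).2 h2⟩

/-- The correlation gap loses a factor `1 - 1/e` between a policy that processes the customers
one by one and the best static one. -/
theorem exists_mul_expectedMatches_le_staticValue {M : Market C S} (hM : M.MonotoneSubmodular)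
    (π : FullPolicy C S) (hπ : π.CustomersFirstAdaptive)
    (h : π.Restrained M (fun _ => none) fun _ => none) :
    ∃ σ, (1 - Real.exp (-1)) * M.expectedMatches π ≤ M.staticValue σ := by
  obtain ⟨w, h0, h1, hw⟩ := π.exists_offer_probabilities hM rfl hπ _ _ h
  obtain ⟨σ, hσ⟩ := M.exists_le_staticValue w h0 h1
  refine ⟨σ, le_trans (correlation_gap hM
    (c := fun i o => ∑ T, w i T * (M.customer i).prob o T) (fun i o => ?_) (fun i => ?_)
    fun R => ?_) hσ⟩
  · exact sum_nonneg fun T _ => mul_nonneg (h0 i T) ((M.customer i).prob_nonneg o T)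
  · rw [sum_comm]
    simp_rw [← mul_sum, ChoiceModel.sum_prob, mul_one, h1]
  · simpa [Market.expectedMatches, backlog] using hw R

theorem expectedMatches_le_mul_optOSBacklog {M : Market C S} (hM : M.MonotoneSubmodular)
    (π : FullPolicy C S) (hπ : π ∈ oneSidedAdaptive C S)
    (h : π.Restrained M (fun _ => none) fun _ => none) :
    M.expectedMatches π ≤ Real.exp 1 / (Real.exp 1 - 1) * M.optOSBacklog := by
  have key : (1 - Real.exp (-1)) * M.expectedMatches π ≤ M.optOSBacklog := by
    rcases hπ with hπ | hπ
    · obtain ⟨σ, hσ⟩ := exists_mul_expectedMatches_le_staticValue hM π hπ h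
      exact hσ.trans (M.staticValue_le_optOSBacklog σ)
    · obtain ⟨τ, hτ⟩ := exists_mul_expectedMatches_le_staticValue hM.swap π.swap
        (π.customersFirstAdaptive_swap.2 hπ) h.swap
      rw [expectedMatches_swap] at hτ
      exact hτ.trans (M.staticValue_swap_le_optOSBacklog τ)
  have he : 0 < Real.exp 1 - 1 := sub_pos.2 (Real.one_lt_exp_iff.2 one_pos)
  have hpos := Real.exp_pos 1
  calc M.expectedMatches π
      = Real.exp 1 / (Real.exp 1 - 1) * ((1 - Real.exp (-1)) * M.expectedMatches π) := by
        rw [Real.exp_neg]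
        field_simp
    _ ≤ _ := mul_le_mul_of_nonneg_left key (div_nonneg hpos.le he.le)

theorem optOABacklog_le {M : Market C S} (hM : M.MonotoneSubmodular) :
    M.optOABacklog ≤ Real.exp 1 / (Real.exp 1 - 1) * M.optOSBacklog :=
  M.opt_le oneSidedAdaptive_inter_backlogOnly_nonempty fun π hπ =>
    expectedMatches_le_mul_optOSBacklog hM π hπ.1 (Or.inr hπ.2)

theorem optOSBacklog_le_optOS (M : Market C S) : M.optOSBacklog ≤ M.optOS :=
  M.opt_mono oneSidedStatic_inter_backlogOnly_nonempty Set.inter_subset_left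

theorem optOABacklog_le_optOA (M : Market C S) : M.optOABacklog ≤ M.optOA :=
  M.opt_mono oneSidedAdaptive_inter_backlogOnly_nonempty Set.inter_subset_left

theorem optOA_le {M : Market C S} (hM : M.MonotoneSubmodular) (hS : M.Substitutable) :
    M.optOA ≤ Real.exp 1 / (Real.exp 1 - 1) * M.optOS := by
  have he : 0 < Real.exp 1 - 1 := sub_pos.2 (Real.one_lt_exp_iff.2 one_pos)
  exact M.opt_le (oneSidedAdaptive_inter_backlogOnly_nonempty.mono Set.inter_subset_left) fun π hπ =>
    (expectedMatches_le_mul_optOSBacklog hM π hπ (Or.inl hS)).trans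
      (mul_le_mul_of_nonneg_left M.optOSBacklog_le_optOS
        (div_nonneg (Real.exp_pos 1).le he.le))

/-- In a market with substitutable choice models, the static policies of both orders are bounded
by the values of their deterministic versions. -/
theorem optOS_le [Nonempty C] [Nonempty S] {M : Market C S} (hM : M.MonotoneSubmodular)
    (hS : M.Substitutable) {K : ℝ} (hC : ∀ σ, M.staticValue σ ≤ K)
    (hC' : ∀ τ, M.swap.staticValue τ ≤ K) : M.optOS ≤ K := by
  refine M.opt_le (oneSidedStatic_inter_backlogOnly_nonempty.mono Set.inter_subset_left) ?_
  rintro π (hπ | hπ)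
  · exact π.value_le_of_customersFirstStatic hM hC rfl rfl hπ _ _ (Or.inl hS)
  · rw [← expectedMatches_swap]
    exact π.swap.value_le_of_customersFirstStatic hM.swap hC' rfl rfl
      (π.customersFirstStatic_swap.2 hπ) _ _ (Or.inl hS.symm)

end Market

end Policies

/-! ### Symmetric choice models -/

namespace ChoiceModel

variable {α : Type*} [DecidableEq α]

/-- The choice model with the demand `g k` at every assortment of `k` alternatives, among which it
chooses uniformly. -/
noncomputable def symmetric (α : Type*) [DecidableEq α] (g : ℕ → ℝ) (h0 : g 0 = 0)
    (hg : ∀ k, 0 ≤ g k ∧ g k ≤ 1) : ChoiceModel α where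
  prob o T := o.elim (1 - g #T) fun j => if j ∈ T then g #T / #T else 0
  prob_nonneg o T := by
    have := hg #T
    cases o with
    | none => exact sub_nonneg.2 this.2
    | some j =>
      have := this.1
      simp only [Option.elim_some]
      positivity
  prob_eq_zero j T hj := by simp [hj]
  sum_eq_one T := by
    rcases T.eq_empty_or_nonempty with rfl | hT
    · simp [h0]
    · have : (#T : ℝ) ≠ 0 := by exact_mod_cast hT.card_pos.ne'
      simp [sum_ite_mem]
      field_simp
      ring

variable {g : ℕ → ℝ} (h0 : g 0 = 0) (hg : ∀ k, 0 ≤ g k ∧ g k ≤ 1)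

theorem symmetric_prob_some (j : α) (T : Finset α) :
    (symmetric α g h0 hg).prob (some j) T = if j ∈ T then g #T / #T else 0 := rfl

theorem symmetric_demand (T : Finset α) : (symmetric α g h0 hg).demand T = g #T := by
  rcases T.eq_empty_or_nonempty with rfl | hT
  · simp [h0, demand]
  · have : (#T : ℝ) ≠ 0 := by exact_mod_cast hT.card_pos.ne'
    simp only [demand, symmetric_prob_some, sum_ite_mem, inter_self, sum_const, nsmul_eq_mul]
    field_simp

theorem monotoneSubmodular_symmetric (hmono : Monotone g)
    (hconc : ∀ k, g (k + 2) - g (k + 1) ≤ g (k + 1) - g k) :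
    (symmetric α g h0 hg).MonotoneSubmodular := by
  refine ⟨fun T T' h => ?_, fun E E' e hE he => ?_⟩
  · simp only [symmetric_demand]
    exact hmono (card_le_card h)
  · simp only [symmetric_demand]
    rw [card_insert_of_notMem he, card_insert_of_notMem fun h => he (hE h)]
    exact antitone_nat_of_succ_le (f := fun k => g (k + 1) - g k) hconc (card_le_card hE)

theorem substitutable_symmetric
    (hratio : ∀ k l : ℕ, 0 < k → k ≤ l → g l / l ≤ g k / k) :
    (symmetric α g h0 hg).Substitutable := by
  intro T T' h
  rcases T.eq_empty_or_nonempty with rfl | hT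
  · simp [demand]
  · have hpos : (0 : ℝ) < #T := by exact_mod_cast hT.card_pos
    rw [symmetric_demand, sum_congr rfl fun j hj => by rw [symmetric_prob_some, if_pos (h hj)],
      sum_const, nsmul_eq_mul, ← le_div_iff₀' hpos]
    exact hratio _ _ hT.card_pos (card_le_card h)

end ChoiceModel

/-! ### The extremal markets -/

/-- The demand of a customer of the extremal market at `k` suppliers. Each of them is chosen with
probability `1 - exp (-1/k)`, so that static policies cannot gain by enlarging assortments. -/
noncomputable def concaveDemand (k : ℕ) : ℝ := k * (1 - Real.exp (-(1 / k)))

theorem concaveDemand_zero : concaveDemand 0 = 0 := by simp [concaveDemand]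

theorem div_add_one_le_concaveDemand (k : ℕ) : (k : ℝ) / (k + 1) ≤ concaveDemand k := by
  rcases k.eq_zero_or_pos with rfl | hk
  · simp [concaveDemand]
  have hk' : (0 : ℝ) < k := by exact_mod_cast hk
  have h1 : Real.exp (-(1 / k)) ≤ 1 / (1 + 1 / k) := by
    rw [Real.exp_neg, ← one_div]
    exact one_div_le_one_div_of_le (by positivity) (by linarith [Real.add_one_le_exp (1 / (k : ℝ))])
  calc (k : ℝ) / (k + 1) = k * (1 - 1 / (1 + 1 / k)) := by
        field_simp
        ring
    _ ≤ _ := mul_le_mul_of_nonneg_left (by linarith) hk'.le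

theorem concaveDemand_mem (k : ℕ) : 0 ≤ concaveDemand k ∧ concaveDemand k ≤ 1 := by
  refine ⟨le_trans (by positivity) (div_add_one_le_concaveDemand k), ?_⟩
  rcases k.eq_zero_or_pos with rfl | hk
  · simp [concaveDemand]
  have hk' : (0 : ℝ) < k := by exact_mod_cast hk
  have := Real.add_one_le_exp (-(1 / (k : ℝ)))
  calc concaveDemand k ≤ k * (1 / k) := mul_le_mul_of_nonneg_left (by linarith) hk'.le
    _ = 1 := by field_simp

theorem monotone_concaveDemand : Monotone concaveDemand := by
  refine monotone_nat_of_le_succ fun k => ?_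
  rcases k.eq_zero_or_pos with rfl | hk
  · rw [concaveDemand_zero]
    exact (concaveDemand_mem _).1
  have hk' : (0 : ℝ) < k := by exact_mod_cast hk
  have h := convexOn_exp.2 (Set.mem_univ (-(1 / (k : ℝ)))) (Set.mem_univ 0)
    (by positivity : 0 ≤ (k : ℝ) / (k + 1)) (by positivity : 0 ≤ 1 / ((k : ℝ) + 1)) (by field_simp)
  have h1 : (k : ℝ) / (k + 1) * -(1 / k) = -(1 / (k + 1)) := by field_simp
  simp only [smul_eq_mul, mul_zero, add_zero, Real.exp_zero, mul_one, h1] at h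
  have h2 := mul_le_mul_of_nonneg_left h (by positivity : (0 : ℝ) ≤ k + 1)
  have h3 : ((k : ℝ) + 1) * (k / (k + 1) * Real.exp (-(1 / k)) + 1 / (k + 1)) =
      k * Real.exp (-(1 / k)) + 1 := by field_simp
  simp only [concaveDemand, Nat.cast_add, Nat.cast_one]
  linarith

theorem concaveDemand_add_two_sub_le (k : ℕ) :
    concaveDemand (k + 2) - concaveDemand (k + 1) ≤ concaveDemand (k + 1) - concaveDemand k := by
  rcases k.eq_zero_or_pos with rfl | hk
  · have : Real.exp (-1) ≤ Real.exp (-(1 / 2)) := Real.exp_le_exp.2 (by norm_num)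
    norm_num [concaveDemand]
    linarith
  have hk' : (0 : ℝ) < k := by exact_mod_cast hk
  have h := convexOn_exp.2 (Set.mem_univ (-(1 / (k : ℝ)))) (Set.mem_univ (-(1 / ((k : ℝ) + 2))))
    (by positivity : 0 ≤ (k : ℝ) / (2 * (k + 1)))
    (by positivity : 0 ≤ ((k : ℝ) + 2) / (2 * (k + 1)))
    (by field_simp; ring)
  have h1 : (k : ℝ) / (2 * (k + 1)) * -(1 / k) + (k + 2) / (2 * (k + 1)) * -(1 / (k + 2)) =
      -(1 / (k + 1)) := by
    field_simp
    ring
  simp only [smul_eq_mul, h1] at h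
  have h2 := mul_le_mul_of_nonneg_left h (by positivity : (0 : ℝ) ≤ 2 * (k + 1))
  have h3 : 2 * ((k : ℝ) + 1) * (k / (2 * (k + 1)) * Real.exp (-(1 / k)) +
      (k + 2) / (2 * (k + 1)) * Real.exp (-(1 / (k + 2)))) =
      k * Real.exp (-(1 / k)) + (k + 2) * Real.exp (-(1 / (k + 2))) := by field_simp
  simp only [concaveDemand, Nat.cast_add, Nat.cast_one, Nat.cast_ofNat]
  linarith

theorem concaveDemand_div {k : ℕ} (hk : 0 < k) :
    concaveDemand k / k = 1 - Real.exp (-(1 / k)) := by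
  have hk' : (0 : ℝ) < k := by exact_mod_cast hk
  rw [concaveDemand]
  field_simp

theorem concaveDemand_div_le {k l : ℕ} (hk : 0 < k) (hkl : k ≤ l) :
    concaveDemand l / l ≤ concaveDemand k / k := by
  rw [concaveDemand_div hk, concaveDemand_div (hk.trans_le hkl)]
  have hk' : (0 : ℝ) < k := by exact_mod_cast hk
  have := one_div_le_one_div_of_le hk' (by exact_mod_cast hkl : (k : ℝ) ≤ l)
  linarith [Real.exp_le_exp.2 (neg_le_neg this)]

theorem concaveDemand_le_mul (k : ℕ) : concaveDemand k ≤ k * (1 - Real.exp (-1)) := by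
  rcases k.eq_zero_or_pos with rfl | hk
  · simp [concaveDemand]
  have hk' : (1 : ℝ) ≤ k := by exact_mod_cast hk
  refine mul_le_mul_of_nonneg_left (sub_le_sub_left (Real.exp_le_exp.2 (neg_le_neg ?_)) _)
    (by positivity)
  rw [div_le_one (by positivity)]
  exact hk'

/-- The demand of an agent who always accepts some offer, if there is one. -/
def unitDemand (k : ℕ) : ℝ := if k = 0 then 0 else 1

theorem unitDemand_mem (k : ℕ) : 0 ≤ unitDemand k ∧ unitDemand k ≤ 1 := by
  unfold unitDemand
  split_ifs <;> norm_num

/-- The markets that attain the gap in the limit. Every supplier takes a uniformly random customer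
out of those on offer, and every customer has the demand `concaveDemand`. An adaptive policy offers
to each customer the suppliers not chosen yet, one of whom is chosen with probability close to `1`
as long as they are many; a static policy offers small assortments, which are often refused, or
large ones, which make several customers choose the same supplier. -/
noncomputable def extremalMarket (n : ℕ) : Market (Fin n) (Fin n) where
  customer _ := .symmetric _ concaveDemand concaveDemand_zero concaveDemand_mem
  supplier _ := .symmetric _ unitDemand rfl unitDemand_mem

namespace extremalMarket

variable {n : ℕ}

theorem monotoneSubmodular (n : ℕ) : (extremalMarket n).MonotoneSubmodular := by
  refine ⟨fun _ => ChoiceModel.monotoneSubmodular_symmetric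
    concaveDemand_zero concaveDemand_mem monotone_concaveDemand
    concaveDemand_add_two_sub_le, fun _ => ChoiceModel.monotoneSubmodular_symmetric rfl
    unitDemand_mem (monotone_nat_of_le_succ fun k => ?_) fun k => ?_⟩
  · simpa [unitDemand] using (unitDemand_mem k).2
  · simpa [unitDemand] using (unitDemand_mem k).2

theorem substitutable (n : ℕ) : (extremalMarket n).Substitutable := by
  refine ⟨fun _ => ChoiceModel.substitutable_symmetric
    concaveDemand_zero concaveDemand_mem fun k l => concaveDemand_div_le,
    fun _ => ChoiceModel.substitutable_symmetric rfl unitDemand_mem fun k l hk hkl => ?_⟩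
  have hk' : (0 : ℝ) < k := by exact_mod_cast hk
  simp only [unitDemand, hk.ne', (hk.trans_le hkl).ne', if_false]
  exact one_div_le_one_div_of_le hk' (by exact_mod_cast hkl)

theorem demand_customer (i : Fin n) (T : Finset (Fin n)) :
    ((extremalMarket n).customer i).demand T = concaveDemand #T :=
  ChoiceModel.symmetric_demand concaveDemand_zero concaveDemand_mem T

theorem demand_supplier (j : Fin n) (T : Finset (Fin n)) :
    ((extremalMarket n).supplier j).demand T = unitDemand #T :=
  ChoiceModel.symmetric_demand rfl unitDemand_mem T

theorem responseValue_eq (x : Fin n → Option (Fin n)) :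
    (extremalMarket n).responseValue x = ∑ j, unitDemand #(backlog x j) := by
  simp [Market.responseValue, demand_supplier]

theorem one_sub_prob (i j : Fin n) (T : Finset (Fin n)) :
    1 - ((extremalMarket n).customer i).prob (some j) T =
      Real.exp (-(if j ∈ T then 1 / (#T : ℝ) else 0)) := by
  simp only [extremalMarket, ChoiceModel.symmetric_prob_some]
  split_ifs with h
  · rw [concaveDemand_div (card_pos.2 ⟨j, h⟩)]
    ring
  · simp

/-- The supplier `j` has an empty backlog with probability `exp (-d j)`, where `d j` is the sum of
`1/k` over the customers who are offered `j` among `k` suppliers. The `d j` add up to at most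
`n`, so that the bound follows from the convexity of the exponential function. -/
theorem staticValue_le (σ : Fin n → Finset (Fin n)) :
    (extremalMarket n).staticValue σ ≤ n * (1 - Real.exp (-1)) := by
  set M := extremalMarket n
  set d : Fin n → ℝ := fun j => ∑ i, if j ∈ σ i then 1 / (#(σ i) : ℝ) else 0 with hd
  have hunit : ∀ (x : Fin n → Option (Fin n)) j,
      unitDemand #(backlog x j) = 1 - ∏ i, if x i = some j then (0 : ℝ) else 1 := by
    intro x j
    unfold unitDemand
    split_ifs with h
    · rw [prod_eq_one, sub_self]
      intro i _
      rw [if_neg fun hi => ?_]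
      rw [card_eq_zero] at h
      exact notMem_empty i (h ▸ mem_backlog.2 hi)
    · obtain ⟨i, hi⟩ := card_pos.1 (Nat.pos_of_ne_zero h)
      rw [prod_eq_zero (mem_univ i) (by rw [if_pos (mem_backlog.1 hi)]), sub_zero]
  have hmiss : ∀ j, ∑ x : Fin n → Option (Fin n), (∏ i, (M.customer i).prob (x i) (σ i)) *
      (∏ i, if x i = some j then (0 : ℝ) else 1) = Real.exp (-d j) := by
    intro j
    simp_rw [← prod_mul_distrib]
    rw [← Fintype.prod_sum fun i o => (M.customer i).prob o (σ i) * if o = some j then (0 : ℝ) else 1,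
      hd, ← sum_neg_distrib, Real.exp_sum]
    refine prod_congr rfl fun i _ => ?_
    have hsplit := add_sum_erase univ (fun o => (M.customer i).prob o (σ i)) (mem_univ (some j))
    rw [(M.customer i).sum_prob] at hsplit
    rw [← one_sub_prob i j, ← add_sum_erase _ _ (mem_univ (some j)), if_pos rfl, mul_zero, zero_add,
      sum_congr rfl fun o ho => by rw [if_neg (ne_of_mem_erase ho), mul_one]]
    exact eq_sub_of_add_eq' hsplit
  have hsum : ∑ j, d j ≤ n := by
    rw [hd, sum_comm]
    calc _ ≤ ∑ i : Fin n, (1 : ℝ) := sum_le_sum fun i _ => by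
          rw [sum_ite_mem, univ_inter, sum_const, nsmul_eq_mul, mul_one_div]
          exact div_self_le_one _
      _ = n := by simp
  calc M.staticValue σ = ∑ j, (1 - Real.exp (-d j)) := by
        simp_rw [Market.staticValue, M, responseValue_eq, hunit, mul_sum, mul_sub, mul_one]
        rw [sum_comm]
        simp_rw [sum_sub_distrib]
        rw [sum_congr rfl fun j _ => hmiss j,
          sum_prod_eq_one (fun i o => (M.customer i).prob o (σ i)) fun i =>
            (M.customer i).sum_prob _]
    _ ≤ ∑ j, (1 - Real.exp (-1) * (2 - d j)) := sum_le_sum fun j _ => by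
        have h := Real.add_one_le_exp (1 - d j)
        have h' : Real.exp (-d j) = Real.exp (-1) * Real.exp (1 - d j) := by
          rw [← Real.exp_add]
          ring_nf
        rw [h']
        have := mul_le_mul_of_nonneg_left h (Real.exp_pos (-1)).le
        linarith
    _ = n - Real.exp (-1) * (2 * n - ∑ j, d j) := by
        simp only [sum_sub_distrib, ← mul_sum, sum_const, card_univ, Fintype.card_fin, nsmul_eq_mul]
        ring
    _ ≤ n * (1 - Real.exp (-1)) := by
        have := mul_le_mul_of_nonneg_left hsum (Real.exp_pos (-1)).le
        linarith

/-- If the suppliers are processed first, then the backlogs of the customers have at most `n` members in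
all, and each member adds at most `1 - 1/e` to the demand of the customer. -/
theorem staticValue_swap_le (τ : Fin n → Finset (Fin n)) :
    (extremalMarket n).swap.staticValue τ ≤ n * (1 - Real.exp (-1)) := by
  set M := extremalMarket n
  have hresp : ∀ y, M.swap.responseValue y ≤ n * (1 - Real.exp (-1)) := by
    intro y
    have hcard : ∑ i, (#(backlog y i) : ℝ) ≤ n := by
      have h1 : ∑ i, #(backlog y i) = #(univ.biUnion fun i => backlog y i) :=
        (card_biUnion fun i _ i' _ hi => disjoint_left.2 fun j hj hj' => hi <| by
          rw [mem_backlog] at hj hj'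
          exact Option.some_injective _ (hj.symm.trans hj')).symm
      exact_mod_cast h1.trans_le ((card_le_univ _).trans_eq (Fintype.card_fin n))
    have he : 0 ≤ 1 - Real.exp (-1) := sub_nonneg.2 (Real.exp_le_one_iff.2 (by norm_num))
    calc M.swap.responseValue y = ∑ i, concaveDemand #(backlog y i) := by
          simp [Market.responseValue, Market.swap, M, demand_customer]
      _ ≤ ∑ i, (#(backlog y i) : ℝ) * (1 - Real.exp (-1)) :=
          sum_le_sum fun i _ => concaveDemand_le_mul _
      _ ≤ _ := by
          rw [← sum_mul]
          exact mul_le_mul_of_nonneg_right hcard he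
  calc M.swap.staticValue τ ≤ ∑ y : Fin n → Option (Fin n),
        (∏ j, (M.swap.customer j).prob (y j) (τ j)) * (n * (1 - Real.exp (-1))) :=
        sum_le_sum fun y _ => mul_le_mul_of_nonneg_left (hresp y)
          (prod_nonneg fun j _ => (M.swap.customer j).prob_nonneg _ _)
    _ = _ := by
        rw [← sum_mul, sum_prod_eq_one (fun j o => (M.swap.customer j).prob o (τ j)) fun j =>
          (M.swap.customer j).sum_prob _, one_mul]

theorem optOS_le (n : ℕ) : (extremalMarket n).optOS ≤ n * (1 - Real.exp (-1)) := by
  rcases n.eq_zero_or_pos with rfl | hn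
  · refine Market.opt_le _
      (oneSidedStatic_inter_backlogOnly_nonempty.mono Set.inter_subset_left) fun π _ => ?_
    simpa [Market.expectedMatches] using
      (π.value_mem_Icc (extremalMarket 0) (fun _ => none) fun _ => none).2
  · have : Nonempty (Fin n) := ⟨⟨0, hn⟩⟩
    exact Market.optOS_le (monotoneSubmodular n) (substitutable n) staticValue_le
      staticValue_swap_le

/-- If a customer without recorded choice chooses a supplier without backlog, then the number of
suppliers with a backlog grows; it never shrinks. -/
theorem responseValue_update_ge {x : Fin n → Option (Fin n)} {a : Fin n} (ha : x a = none)
    (o : Option (Fin n)) :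
    (extremalMarket n).responseValue x + (if ∃ j, o = some j ∧ backlog x j = ∅ then 1 else 0) ≤
      (extremalMarket n).responseValue (Function.update x a o) := by
  have hmono : ∀ j, backlog x j ⊆ backlog (Function.update x a o) j := by
    intro j i hi
    rw [mem_backlog] at hi ⊢
    rw [Function.update_of_ne fun h => ?_, hi]
    subst h
    simp [ha] at hi
  have hterm : ∀ j, unitDemand #(backlog x j) ≤ unitDemand #(backlog (Function.update x a o) j) :=
    fun j => monotone_nat_of_le_succ (f := unitDemand)
      (fun k => by simpa [unitDemand] using (unitDemand_mem k).2) (card_le_card (hmono j))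
  simp only [responseValue_eq]
  split_ifs with h
  · obtain ⟨j, rfl, hj⟩ := h
    rw [← add_sum_erase _ _ (mem_univ j), ← add_sum_erase univ
      (fun j' => unitDemand #(backlog (Function.update x a (some j)) j')) (mem_univ j)]
    have h1 : unitDemand #(backlog (Function.update x a (some j)) j) = 1 := by
      rw [unitDemand, if_neg]
      exact (card_pos.2 ⟨a, by simp⟩).ne'
    have h2 : unitDemand #(backlog x j) = 0 := by simp [hj, unitDemand]
    rw [h1, h2, zero_add, add_comm]
    exact add_le_add_right (sum_le_sum fun j' _ => hterm j') 1
  · rw [add_zero]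
    exact sum_le_sum fun j _ => hterm j

/-- Each of the `k` remaining customers is offered all the suppliers without backlog. There are always
at least as many of them as remaining customers, so that the customer who is followed by `s` others
gains at least `concaveDemand (s + 1)`. -/
theorem exists_adaptive (k : ℕ) {RC RS : Finset (Fin n)} (hRC : #RC = k) (hRS : RS = univ)
    (x : Fin n → Option (Fin n)) (hx : ∀ i ∈ RC, x i = none)
    (hk : k ≤ #{j | backlog x j = ∅}) (y : Fin n → Option (Fin n)) :
    ∃ π : Policy (Fin n) (Fin n) RC RS, π.CustomersFirstAdaptive ∧ π.OffersBacklog x y ∧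
      (extremalMarket n).responseValue x + ∑ s ∈ range k, concaveDemand (s + 1) ≤
        π.value (extremalMarket n) x y := by
  set M := extremalMarket n with hM
  induction k generalizing RC RS x y with
  | zero =>
    obtain ⟨π, -, h1, h2, h3⟩ :=
      Policy.exists_value_eq_responseValue M (card_eq_zero.1 hRC) hRS x
    exact ⟨π, h1, h2 y, by simp [h3]⟩
  | succ k ih =>
    obtain ⟨a, ha⟩ := card_pos.1 (show 0 < #RC by omega)
    have hs : {a} ⊆ RC := singleton_subset_iff.2 ha
    set U : Finset (Fin n) := {j | backlog x j = ∅} with hU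
    have hxa := hx a ha
    have hstep : ∀ o : Option (Fin n), k ≤ #{j | backlog (Function.update x a o) j = ∅} := by
      intro o
      have hsub : o.elim U U.erase ⊆ ({j | backlog (Function.update x a o) j = ∅} : Finset _) := by
        intro j hj
        have hj' : backlog x j = ∅ ∧ o ≠ some j := by
          cases o with
          | none => simpa [hU] using hj
          | some j' =>
            simp only [Option.elim_some, mem_erase, hU, mem_filter, mem_univ, true_and] at hj
            exact ⟨hj.2, fun h => hj.1 (Option.some_injective _ h).symm⟩
        rw [mem_filter]
        refine ⟨mem_univ j, eq_empty_of_forall_notMem fun i hi => ?_⟩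
        rw [mem_backlog] at hi
        by_cases hia : i = a
        · subst hia
          rw [Function.update_self] at hi
          exact hj'.2 hi
        · rw [Function.update_of_ne hia] at hi
          exact notMem_empty i (hj'.1 ▸ mem_backlog.2 hi)
      refine le_trans ?_ (card_le_card hsub)
      cases o with
      | none => exact (Nat.le_succ k).trans hk
      | some j =>
        have := pred_card_le_card_erase (s := U) (a := j)
        simp only [Option.elim_some]
        omega
    choose π h1 h2 h3 using fun o : Option (Fin n) => ih (RC := RC \ {a}) (RS := RS \ ∅)
      (by rw [card_sdiff_of_subset hs, hRC, card_singleton]; rfl) (by simp [hRS])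
      (Function.update x a o) (fun i hi => by
        rw [mem_sdiff, mem_singleton] at hi
        rw [Function.update_of_ne hi.2, hx i hi.1]) (hstep o) y
    refine ⟨.process {a} ∅ hs (by simp) (fun _ => U) (fun _ => ∅) fun u _ =>
      π (u ⟨a, mem_singleton_self a⟩), ?_, ?_, ?_⟩
    · rw [Policy.CustomersFirstAdaptive]
      exact ⟨fun _ => ⟨card_singleton a, rfl⟩, fun u v => h1 _⟩
    · rw [Policy.OffersBacklog]
      refine ⟨fun _ j => absurd j.2 (notMem_empty _), fun hS => ?_, fun u v => ?_⟩
      · exact absurd (mem_univ a) (by rw [← hRS, hS]; exact notMem_empty a)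
      · rw [record_singleton, record_empty]
        exact h2 _
    · rw [Policy.value_process_singleton]
      have hp : ∀ o, 0 ≤ (M.customer a).prob o U := fun o => (M.customer a).prob_nonneg o U
      have hone := (M.customer a).sum_prob U
      have hgain : ∑ o, (M.customer a).prob o U *
          (if ∃ j, o = some j ∧ backlog x j = ∅ then (1 : ℝ) else 0) = concaveDemand #U := by
        have hdem : (M.customer a).demand U = concaveDemand #U :=
          demand_customer a U
        rw [Fintype.sum_option, ← hdem, ChoiceModel.demand, hU, sum_filter]
        simp
      calc M.responseValue x + ∑ s ∈ range (k + 1), concaveDemand (s + 1)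
          ≤ M.responseValue x + (concaveDemand #U + ∑ s ∈ range k, concaveDemand (s + 1)) := by
            rw [sum_range_succ]
            linarith [monotone_concaveDemand hk]
        _ = ∑ o, (M.customer a).prob o U * (M.responseValue x +
              (if ∃ j, o = some j ∧ backlog x j = ∅ then (1 : ℝ) else 0) +
              ∑ s ∈ range k, concaveDemand (s + 1)) := by
            simp_rw [mul_add, sum_add_distrib]
            rw [hgain, ← sum_mul, ← sum_mul, hone]
            ring
        _ ≤ _ := sum_le_sum fun o _ => mul_le_mul_of_nonneg_left
            ((add_le_add_left (responseValue_update_ge hxa o) _).trans (h3 o)) (hp o)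

theorem sum_concaveDemand_le_optOABacklog (n : ℕ) :
    ∑ s ∈ range n, concaveDemand (s + 1) ≤ (extremalMarket n).optOABacklog := by
  obtain ⟨π, h1, h2, h3⟩ := exists_adaptive n (RC := univ) (RS := univ) (card_fin n) rfl
    (fun _ => none) (fun _ _ => rfl) (by simp [backlog]) fun _ => none
  have h4 : 0 ≤ (extremalMarket n).responseValue fun _ => none := by
    rw [responseValue_eq]
    exact sum_nonneg fun j _ => (unitDemand_mem _).1
  exact (le_add_of_nonneg_left h4).trans (h3.trans
    (Market.expectedMatches_le_opt _ ⟨Or.inl h1, h2⟩))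

open Filter Topology

/-- If the optimal values `a n` and `b n` of adaptive and static policies on the extremal markets
satisfy the general bounds, then their ratios converge. -/
theorem tendsto_ratio {a b : ℕ → ℝ}
    (hlow : ∀ n, ∑ s ∈ range n, concaveDemand (s + 1) ≤ a n)
    (hup : ∀ n, b n ≤ n * (1 - Real.exp (-1)))
    (hab : ∀ n, a n ≤ Real.exp 1 / (Real.exp 1 - 1) * b n) :
    (∀ n, 0 < n → 0 < b n) ∧
      Tendsto (fun n => a n / b n) atTop (𝓝 (Real.exp 1 / (Real.exp 1 - 1))) := by
  have he : 0 < Real.exp 1 - 1 := sub_pos.2 (Real.one_lt_exp_iff.2 one_pos)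
  have hκ : 0 < Real.exp 1 / (Real.exp 1 - 1) := div_pos (Real.exp_pos 1) he
  have ha : ∀ n, 0 < n → 0 < a n := fun n hn => lt_of_lt_of_le
    (sum_pos (fun s _ => lt_of_lt_of_le (by positivity) (div_add_one_le_concaveDemand (s + 1)))
      (nonempty_range_iff.2 hn.ne')) (hlow n)
  have hb : ∀ n, 0 < n → 0 < b n := fun n hn =>
    pos_of_mul_pos_right ((ha n hn).trans_le (hab n)) hκ.le
  refine ⟨hb, ?_⟩
  have hlim : Tendsto concaveDemand atTop (𝓝 1) :=
    tendsto_of_tendsto_of_tendsto_of_le_of_le (tendsto_natCast_div_add_atTop (1 : ℝ))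
      tendsto_const_nhds div_add_one_le_concaveDemand fun k => (concaveDemand_mem k).2
  have hmean := ((tendsto_add_atTop_iff_nat 1).2 hlim).cesaro.const_mul
    (Real.exp 1 / (Real.exp 1 - 1))
  rw [mul_one] at hmean
  refine tendsto_of_tendsto_of_tendsto_of_le_of_le' hmean tendsto_const_nhds ?_ ?_
  · filter_upwards [eventually_gt_atTop 0] with n hn
    have hn' : (0 : ℝ) < n := by exact_mod_cast hn
    rw [le_div_iff₀ (hb n hn)]
    have hS : 0 ≤ ∑ s ∈ range n, concaveDemand (s + 1) :=
      sum_nonneg fun s _ => (concaveDemand_mem _).1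
    calc _ ≤ Real.exp 1 / (Real.exp 1 - 1) *
          ((n : ℝ)⁻¹ * ∑ s ∈ range n, concaveDemand (s + 1)) * (n * (1 - Real.exp (-1))) :=
          mul_le_mul_of_nonneg_left (hup n) (by positivity)
      _ = ∑ s ∈ range n, concaveDemand (s + 1) := by
          rw [Real.exp_neg]
          field_simp
      _ ≤ a n := hlow n
  · filter_upwards [eventually_gt_atTop 0] with n hn
    rw [div_le_iff₀ (hb n hn)]
    exact hab n

end extremalMarket

/-! ### The gap is exactly `e / (e - 1)` -/

theorem theorem1 :
    -- (A) responding agents are offered only agents who have chosen them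
    ((∀ (n m : ℕ) (M : Market (Fin n) (Fin m)), M.MonotoneSubmodular →
        M.optOABacklog ≤ Real.exp 1 / (Real.exp 1 - 1) * M.optOSBacklog) ∧
      IsLUB {r : ℝ | ∃ (n m : ℕ) (M : Market (Fin n) (Fin m)), M.MonotoneSubmodular ∧
          0 < M.optOSBacklog ∧ r = M.optOABacklog / M.optOSBacklog}
        (Real.exp 1 / (Real.exp 1 - 1))) ∧
    -- (B) unrestricted assortments, substitutable choice models
    ((∀ (n m : ℕ) (M : Market (Fin n) (Fin m)), M.MonotoneSubmodular → M.Substitutable →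
        M.optOA ≤ Real.exp 1 / (Real.exp 1 - 1) * M.optOS) ∧
      IsLUB {r : ℝ | ∃ (n m : ℕ) (M : Market (Fin n) (Fin m)),
          M.MonotoneSubmodular ∧ M.Substitutable ∧ 0 < M.optOS ∧ r = M.optOA / M.optOS}
        (Real.exp 1 / (Real.exp 1 - 1))) ∧
    -- (C) a family of instances, with n customers and n suppliers, along which both ratios converge
    (∃ M : ∀ n : ℕ, Market (Fin n) (Fin n),
      (∀ n, (M n).MonotoneSubmodular ∧ (M n).Substitutable) ∧
      Filter.Tendsto (fun n : ℕ => (M n).optOABacklog / (M n).optOSBacklog)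
        Filter.atTop (nhds (Real.exp 1 / (Real.exp 1 - 1))) ∧
      Filter.Tendsto (fun n : ℕ => (M n).optOA / (M n).optOS)
        Filter.atTop (nhds (Real.exp 1 / (Real.exp 1 - 1)))) := by
  have hlim := fun a b h1 h2 h3 => extremalMarket.tendsto_ratio (a := a) (b := b) h1 h2 h3
  have hb := hlim (fun n => (extremalMarket n).optOABacklog)
    (fun n => (extremalMarket n).optOSBacklog) extremalMarket.sum_concaveDemand_le_optOABacklog
    (fun n => (extremalMarket n).optOSBacklog_le_optOS.trans (extremalMarket.optOS_le n))
    fun n => Market.optOABacklog_le (extremalMarket.monotoneSubmodular n)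
  have hu := hlim (fun n => (extremalMarket n).optOA) (fun n => (extremalMarket n).optOS)
    (fun n => (extremalMarket.sum_concaveDemand_le_optOABacklog n).trans
      (extremalMarket n).optOABacklog_le_optOA) extremalMarket.optOS_le
    fun n => Market.optOA_le (extremalMarket.monotoneSubmodular n) (extremalMarket.substitutable n)
  refine ⟨⟨fun n m M hM => Market.optOABacklog_le hM, ?_, fun K hK => ?_⟩,
    ⟨fun n m M hM hS => Market.optOA_le hM hS, ?_, fun K hK => ?_⟩, extremalMarket,
    fun n => ⟨extremalMarket.monotoneSubmodular n, extremalMarket.substitutable n⟩, hb.2, hu.2⟩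
  · rintro _ ⟨n, m, M, hM, hpos, rfl⟩
    exact (div_le_iff₀ hpos).2 (Market.optOABacklog_le hM)
  · refine le_of_tendsto hb.2 ?_
    filter_upwards [Filter.eventually_gt_atTop 0] with n hn
    exact hK ⟨n, n, _, extremalMarket.monotoneSubmodular n, hb.1 n hn, rfl⟩
  · rintro _ ⟨n, m, M, hM, hS, hpos, rfl⟩
    exact (div_le_iff₀ hpos).2 (Market.optOA_le hM hS)
  · refine le_of_tendsto hu.2 ?_
    filter_upwards [Filter.eventually_gt_atTop 0] with n hn
    exact hK ⟨n, n, _, extremalMarket.monotoneSubmodular n, extremalMarket.substitutable n,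
      hu.1 n hn, rfl⟩
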